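/- **Model.** A dynamic path network consists of $n\ge 1$ vertices $v_1,\dots,v_n$ arranged from left to right, where $v_i$ has a positive integer weight $w_i$ (the number of evacuees at $v_i$ at time $0$), the edge $e_i=(v_i,v_{i+1})$ has a real length $l_i\ge 0$ and a real capacity $c_i>0$, and the transit time per unit distance is $\tau>0$. Uniform edge capacities means that all $c_i$ are equal. A point of the path is a vertex, or an interior point of an edge given by that edge and the distance $x$, $0<x<l_i$, from its left end. Evacuees form a continuous flow: at most $c_i$ of them enter $e_i$ (from one end) per unit time, they travel at $\tau$ time units per unit distance, and they may wait at vertices. A sink has infinite capacity, so that the evacuees reaching it from its left and from its right do not interfere; evacuees at a vertex where their sink lies are evacuated at time $0$. A family of $k$ sinks (points $s_1,\dots,s_k$ of the path) allows evacuation within time $t$ if the path can be cut into consecutive, vertex-disjoint subpaths $P_1,\dots,P_k$ covering all vertices (some possibly empty, their sinks then being unused) such that each nonempty $P_j$ contains $s_j$ and all evacuees of the vertices of $P_j$ can reach $s_j$ within time $t$ by a flow in $P_j$. An optimal $k$-sink is a family of $k$ sinks that allows evacuation within a time $t$ such that no $k$ sinks allow evacuation within any time $t'<t$. Algorithms are programs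 for the unit-cost real RAM: exact real arithmetic ($+,-,\times,/$), comparison of reals, rational constants and no rounding, together with random-access memory and integer words of $O(\log(n+k))$ bits. The input $n,k,\tau,(w_i),(l_i),(c_i)$ is given in memory, and the $k$ sinks have to be written to memory, each as a vertex or edge index together with an offset. **Theorem.** There are a real-RAM program and a constant $C$ such that for every dynamic path network with $n\ge 1$ vertices and uniform edge capacities and every $k\ge 1$ (with $k=1$ if $n=1$), the program, given the network and $k$, halts within $C\,(n+k^2\log^2 n)$ steps and outputs an optimal $k$-sink. That is, an optimal $k$-sink can be found in $O(n+k^2\log^2 n)$ time. -/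

import Mathlib

/-! ## A uniform-cost real RAM with structured programs

The memory has word variables and word arrays (holding natural numbers), and real variables and
real arrays.  Programs are finite texts.  Every arithmetic operation, memory access, comparison,
assignment and branching costs one unit.  Words that are stored may not exceed the word limit `B`.
There is no conversion of reals to words (no rounding), and the only literal reals are rationals. -/

namespace RealRAM

/-- Expressions of word type (subtraction is truncated, division rounds down). -/
inductive NExpr : Type
  | const (c : ℕ)
  | var (x : ℕ)
  | get (a : ℕ) (e : NExpr)
  | add (e f : NExpr)
  | sub (e f : NExpr)
  | mul (e f : NExpr)
  | div (e f : NExpr)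

/-- Expressions of real type. -/
inductive RExpr : Type
  | const (q : ℚ)
  | var (x : ℕ)
  | get (a : ℕ) (e : NExpr)
  | ofWord (e : NExpr)
  | add (e f : RExpr)
  | sub (e f : RExpr)
  | mul (e f : RExpr)
  | div (e f : RExpr)

/-- Tests. -/
inductive BExpr : Type
  | nlt (e f : NExpr)
  | rlt (e f : RExpr)
  | not (b : BExpr)
  | and (b c : BExpr)

/-- Programs. -/
inductive Prog : Type
  | skip
  | nset (x : ℕ) (e : NExpr)
  | nput (a : ℕ) (i e : NExpr)
  | rset (x : ℕ) (e : RExpr)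
  | rput (a : ℕ) (i : NExpr) (e : RExpr)
  | seq (p q : Prog)
  | ite (b : BExpr) (p q : Prog)
  | loop (b : BExpr) (p : Prog)

/-- The contents of the memory: word variables, real variables, word arrays, real arrays. -/
structure Store : Type where
  nvar : ℕ → ℕ
  rvar : ℕ → ℝ
  narr : ℕ → ℕ → ℕ
  rarr : ℕ → ℕ → ℝ

/-- The value of a word expression. -/
def NExpr.eval (σ : Store) : NExpr → ℕ
  | .const c => c
  | .var x => σ.nvar x
  | .get a e => σ.narr a (e.eval σ)
  | .add e f => e.eval σ + f.eval σ
  | .sub e f => e.eval σ - f.eval σ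
  | .mul e f => e.eval σ * f.eval σ
  | .div e f => e.eval σ / f.eval σ

/-- The number of unit-cost operations in the evaluation of a word expression. -/
def NExpr.cost : NExpr → ℕ
  | .const _ => 1
  | .var _ => 1
  | .get _ e => e.cost + 1
  | .add e f => e.cost + f.cost + 1
  | .sub e f => e.cost + f.cost + 1
  | .mul e f => e.cost + f.cost + 1
  | .div e f => e.cost + f.cost + 1

/-- The value of a real expression. -/
noncomputable def RExpr.eval (σ : Store) : RExpr → ℝ
  | .const q => (q : ℝ)
  | .var x => σ.rvar x
  | .get a e => σ.rarr a (e.eval σ)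
  | .ofWord e => (e.eval σ : ℝ)
  | .add e f => e.eval σ + f.eval σ
  | .sub e f => e.eval σ - f.eval σ
  | .mul e f => e.eval σ * f.eval σ
  | .div e f => e.eval σ / f.eval σ

/-- The number of unit-cost operations in the evaluation of a real expression. -/
def RExpr.cost : RExpr → ℕ
  | .const _ => 1
  | .var _ => 1
  | .get _ e => e.cost + 1
  | .ofWord e => e.cost + 1
  | .add e f => e.cost + f.cost + 1
  | .sub e f => e.cost + f.cost + 1
  | .mul e f => e.cost + f.cost + 1
  | .div e f => e.cost + f.cost + 1

/-- The truth of a test. -/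
def BExpr.holds (σ : Store) : BExpr → Prop
  | .nlt e f => e.eval σ < f.eval σ
  | .rlt e f => e.eval σ < f.eval σ
  | .not b => ¬ b.holds σ
  | .and b c => b.holds σ ∧ c.holds σ

/-- The number of unit-cost operations in a test. -/
def BExpr.cost : BExpr → ℕ
  | .nlt e f => e.cost + f.cost + 1
  | .rlt e f => e.cost + f.cost + 1
  | .not b => b.cost + 1
  | .and b c => b.cost + c.cost + 1

/-- Assign to a word variable. -/
def Store.setN (σ : Store) (x v : ℕ) : Store :=
  { σ with nvar := Function.update σ.nvar x v }

/-- Assign to a real variable. -/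
def Store.setR (σ : Store) (x : ℕ) (v : ℝ) : Store :=
  { σ with rvar := Function.update σ.rvar x v }

/-- Write into entry `i` of the word array `a`. -/
def Store.putN (σ : Store) (a i v : ℕ) : Store :=
  { σ with narr := Function.update σ.narr a (Function.update (σ.narr a) i v) }

/-- Write into entry `i` of the real array `a`. -/
def Store.putR (σ : Store) (a i : ℕ) (v : ℝ) : Store :=
  { σ with rarr := Function.update σ.rarr a (Function.update (σ.rarr a) i v) }

/-- `Exec B p σ T σ'`: with word limit `B`, the program `p`, started on `σ`, halts after `T` units
of time with memory `σ'`.  A program that tries to store a word above the limit does not halt. -/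
inductive Exec (B : ℕ) : Prog → Store → ℕ → Store → Prop
  | skip (σ : Store) : Exec B .skip σ 1 σ
  | nset (σ : Store) (x : ℕ) (e : NExpr) (h : e.eval σ ≤ B) :
      Exec B (.nset x e) σ (e.cost + 1) (σ.setN x (e.eval σ))
  | nput (σ : Store) (a : ℕ) (i e : NExpr) (h : e.eval σ ≤ B) :
      Exec B (.nput a i e) σ (i.cost + e.cost + 1) (σ.putN a (i.eval σ) (e.eval σ))
  | rset (σ : Store) (x : ℕ) (e : RExpr) :
      Exec B (.rset x e) σ (e.cost + 1) (σ.setR x (e.eval σ))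
  | rput (σ : Store) (a : ℕ) (i : NExpr) (e : RExpr) :
      Exec B (.rput a i e) σ (i.cost + e.cost + 1) (σ.putR a (i.eval σ) (e.eval σ))
  | seq {p q : Prog} {σ σ₁ σ₂ : Store} {T₁ T₂ : ℕ} :
      Exec B p σ T₁ σ₁ → Exec B q σ₁ T₂ σ₂ → Exec B (.seq p q) σ (T₁ + T₂) σ₂
  | ite_true {b : BExpr} {p q : Prog} {σ σ' : Store} {T : ℕ} :
      b.holds σ → Exec B p σ T σ' → Exec B (.ite b p q) σ (b.cost + 1 + T) σ'
  | ite_false {b : BExpr} {p q : Prog} {σ σ' : Store} {T : ℕ} :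
      ¬ b.holds σ → Exec B q σ T σ' → Exec B (.ite b p q) σ (b.cost + 1 + T) σ'
  | loop_done {b : BExpr} {p : Prog} {σ : Store} :
      ¬ b.holds σ → Exec B (.loop b p) σ (b.cost + 1) σ
  | loop_step {b : BExpr} {p : Prog} {σ σ₁ σ₂ : Store} {T₁ T₂ : ℕ} :
      b.holds σ → Exec B p σ T₁ σ₁ → Exec B (.loop b p) σ₁ T₂ σ₂ →
      Exec B (.loop b p) σ (b.cost + 1 + T₁ + T₂) σ₂

end RealRAM

/-! ## Dynamic path networks -/

/-- A dynamic path network with `n ≥ 1` vertices `v_0, …, v_{n-1}` from left to right, where the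
edge `e_i` joins `v_i` and `v_{i+1}` for `i + 1 < n`.  Only the weights of index `i < n` and the
lengths and capacities of index `i` with `i + 1 < n` are meaningful; nothing below looks at the
others.  The number `τ` is the transit time per unit distance. -/
structure PathNetwork : Type where
  n : ℕ
  n_pos : 0 < n
  weight : ℕ → ℕ
  weight_pos : ∀ i, i < n → 0 < weight i
  len : ℕ → ℝ
  len_nonneg : ∀ i, i + 1 < n → 0 ≤ len i
  cap : ℕ → ℝ
  cap_pos : ∀ i, i + 1 < n → 0 < cap i
  τ : ℝ
  τ_pos : 0 < τ

namespace PathNetwork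

/-- All edges have the same capacity. -/
def IsUniform (N : PathNetwork) : Prop :=
  ∀ i j, i + 1 < N.n → j + 1 < N.n → N.cap i = N.cap j

/-- The distance of `v_i` from the left end of the path. -/
noncomputable def pos (N : PathNetwork) (i : ℕ) : ℝ :=
  ∑ j ∈ Finset.range i, N.len j

/-- A point of the path: the vertex `v_idx` if `off = 0`, and otherwise the interior point of the
edge `e_idx` at distance `off` from `v_idx`. -/
structure Point (N : PathNetwork) : Type where
  idx : ℕ
  off : ℝ
  idx_lt : idx < N.n
  off_nonneg : 0 ≤ off
  off_lt : off = 0 ∨ (idx + 1 < N.n ∧ off < N.len idx)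

variable {N : PathNetwork}

/-- The distance of a point from the left end of the path. -/
noncomputable def Point.pos (s : N.Point) : ℝ :=
  N.pos s.idx + s.off

/-- The vertex `v_h` lies strictly to the left of the point `s`. -/
def Point.VertexLeft (s : N.Point) (h : ℕ) : Prop :=
  h < s.idx ∨ (h = s.idx ∧ 0 < s.off)

/-- The vertex `v_h` lies strictly to the right of the point `s`. -/
def Point.VertexRight (s : N.Point) (h : ℕ) : Prop :=
  s.idx < h

/-- The point `s` lies on the subpath with vertices `v_h`, `a ≤ h < b`. -/
def Point.OnSubpath (s : N.Point) (a b : ℕ) : Prop :=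
  a ≤ s.idx ∧ (s.idx + 1 < b ∨ (s.idx + 1 = b ∧ s.off = 0))

/-- `F t` is a possible total number of evacuees that have entered, up to time `t`, an edge of
capacity `c` at one of its ends: the flow starts at time `0`, nobody turns back, and at most `c`
evacuees enter per unit of time. -/
def IsInflow (c : ℝ) (F : ℝ → ℝ) : Prop :=
  (∀ t, t ≤ 0 → F t = 0) ∧ Monotone F ∧ ∀ t t', t ≤ t' → F t' - F t ≤ c * (t' - t)

/-- All evacuees of the vertices `v_h`, `a ≤ h < b`, can reach the sink `s` within time `T`, in the
continuous flow model in which `w_h` evacuees are at `v_h` at time `0`, evacuees may wait at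
vertices, and the flows from the two sides of the sink do not interfere.

For a vertex `v_h` to the left (right) of `s`, the number `F h t` is the total number of evacuees
who by time `t` have left `v_h` along the next edge to the right (left).  It cannot exceed
`w_h` plus the number of those who by then have arrived from the neighbour on the far side.  The
evacuees of one side have all reached `s` at time `T` if all of them have left the last vertex
before `s` early enough to cover the remaining distance. -/
def EvacuatesWithin (N : PathNetwork) (a b : ℕ) (s : N.Point) (T : ℝ) : Prop :=
  0 ≤ T ∧ ∃ F : ℕ → ℝ → ℝ,
    (∀ h, a ≤ h → h < b → s.VertexLeft h →
      IsInflow (N.cap h) (F h) ∧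
      (∀ t, F h t ≤ N.weight h +
        if a < h then F (h - 1) (t - N.len (h - 1) * N.τ) else 0) ∧
      (¬ s.VertexLeft (h + 1) →
        F h (T - (s.pos - N.pos h) * N.τ) = ∑ i ∈ Finset.Icc a h, (N.weight i : ℝ))) ∧
    (∀ h, a ≤ h → h < b → s.VertexRight h →
      IsInflow (N.cap (h - 1)) (F h) ∧
      (∀ t, F h t ≤ N.weight h +
        if h + 1 < b then F (h + 1) (t - N.len h * N.τ) else 0) ∧
      (¬ s.VertexRight (h - 1) →
        F h (T - (N.pos h - s.pos) * N.τ) = ∑ i ∈ Finset.Ico h b, (N.weight i : ℝ)))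

/-- With the sinks `S 0, …, S (k-1)`, every evacuee can reach a sink within time `t`: the path can
be cut into consecutive subpaths, the `j`-th one with the vertices `v_h`, `β j ≤ h < β (j+1)`
(possibly none, in which case the sink `S j` is not used), such that each nonempty one contains its
sink and can be evacuated to it within time `t`. -/
def SinksEvacuate (N : PathNetwork) {k : ℕ} (S : Fin k → N.Point) (t : ℝ) : Prop :=
  ∃ β : ℕ → ℕ, Monotone β ∧ β 0 = 0 ∧ β k = N.n ∧
    ∀ j : Fin k, β j < β (j + 1) →
      (S j).OnSubpath (β j) (β (j + 1)) ∧ N.EvacuatesWithin (β j) (β (j + 1)) (S j) t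

/-- `(t,k)`-feasibility. -/
def Feasible (N : PathNetwork) (t : ℝ) (k : ℕ) : Prop :=
  ∃ S : Fin k → N.Point, N.SinksEvacuate S t

/-- `S` is an optimal `k`-sink: it allows evacuation within some time `t` that is the least
possible one for `k` sinks. -/
def IsOptimalSink (N : PathNetwork) {k : ℕ} (S : Fin k → N.Point) : Prop :=
  ∃ t : ℝ, N.SinksEvacuate S t ∧ ∀ t', N.Feasible t' k → t ≤ t'

/-- The memory at the start: `n` and `k` in the word variables `0` and `1`, `τ` in the real variable
`0`, the weights, lengths and capacities in the real arrays `0`, `1`, `2`, and zeros elsewhere. -/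
noncomputable def input (N : PathNetwork) (k : ℕ) : RealRAM.Store where
  nvar x := if x = 0 then N.n else if x = 1 then k else 0
  rvar x := if x = 0 then N.τ else 0
  narr _ _ := 0
  rarr a i :=
    if a = 0 ∧ i < N.n then (N.weight i : ℝ)
    else if a = 1 ∧ i + 1 < N.n then N.len i
    else if a = 2 ∧ i + 1 < N.n then N.cap i
    else 0

/-- At the end, the sinks `S 0, …, S (k-1)` are written in the memory: the vertex or edge index of
`S j` in the word array `0`, and its offset in the real array `3`. -/
def IsOutput {k : ℕ} (σ : RealRAM.Store) (S : Fin k → N.Point) : Prop :=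
  ∀ j : Fin k, σ.narr 0 j = (S j).idx ∧ σ.rarr 3 j = (S j).off

end PathNetwork

/-!
Write `load i` for the time that the evacuees of `v_0, …, v_{i-1}` need for passing through one
point of an edge, and `travel i` for the travel time from `v_0` to `v_i`.

*One sink.*  With uniform capacities, no flow brings the evacuees of `v_a, …, v_i` to a sink at
travel time `x` from `v_0` before `load (i + 1) - load a + x - travel i`, and the flow in which
everybody leaves as early as possible attains the maximum of these bounds over the vertices `v_i`
on the left of the sink; likewise on the right (`PathNetwork.IsUniform.evacuatesWithin_iff`).  The
evacuation time of a subpath is therefore given by maxima of two fixed sequences, `keyL` and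
`keyR`, over ranges of indices.  Two complete binary trees of maxima, built in linear time, give
access to them.

*Feasibility.*  Whether `k` sinks suffice for a time `t` is decided greedily: put the next sink as
far to the right as the evacuees from its left permit, and let it serve as many vertices on its
right as it can (`PathNetwork.GreedyStep.max`, `PathNetwork.Greedy.eq_n_iff`).  Either half of such
a step looks for the last index at which a certain threshold, which does not depend on `t`, is at
most `t` (`PathNetwork.leftTime`, `PathNetwork.rightTime`).  A search in a tree of maxima, which
tries larger and larger blocks and then smaller and smaller ones, finds it with `O(log n)`
comparisons (`RealRAM.run_search`).  Hence a test of feasibility takes `O(k log n)` time.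

*Optimization.*  The greedy placement uses `t` in comparisons with thresholds only, so that it can
be carried out for the unknown optimal time: a comparison with it amounts to a test of feasibility
of the threshold.  The `O(k log n)` comparisons take `O(k² log² n)` time altogether.  They yield an
infeasible lower bound `lo` and a feasible upper bound `hi` such that the greedy placement takes
the same course for all times `t` with `lo ≤ t < hi`; were one of these feasible, then so would be
`lo`.  Hence `hi` is optimal (`RealRAM.hi_le_of_greedy`).

Programs are verified with a total-correctness judgement `RealRAM.Run` that also bounds the running
time.  One program for a greedy step serves both for the test and for the parametric search, the
comparison being a parameter that is specified by `RealRAM.Oracle`.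
-/

/-! ### Total correctness with running time -/

namespace RealRAM

/-- The word variables respect the word limit. -/
def Store.Bounded (B : ℕ) (σ : Store) : Prop := ∀ x, σ.nvar x ≤ B

/-- Started on a memory `σ` that respects the word limit, the program `p` halts within `c` units of
time with such a memory satisfying `Q`. -/
def Run (B : ℕ) (p : Prog) (σ : Store) (c : ℕ) (Q : Store → Prop) : Prop :=
  σ.Bounded B → ∃ T σ', Exec B p σ T σ' ∧ T ≤ c ∧ σ'.Bounded B ∧ Q σ'

section
variable {B : ℕ} {p q : Prog} {σ : Store} {c c₁ c₂ : ℕ} {Q R : Store → Prop}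

lemma Run.of_bounded (h : σ.Bounded B → Run B p σ c Q) : Run B p σ c Q := fun hb => h hb hb

lemma Run.mono (h : Run B p σ c₁ R) (hc : c₁ ≤ c) (hQ : ∀ σ', R σ' → Q σ') : Run B p σ c Q := by
  intro hb
  obtain ⟨T, σ', hE, hT, hb', hR⟩ := h hb
  exact ⟨T, σ', hE, hT.trans hc, hb', hQ _ hR⟩

lemma Run.skip (h : Q σ) : Run B .skip σ 1 Q := fun hb => ⟨_, _, .skip σ, le_rfl, hb, h⟩

lemma Run.nset {x : ℕ} {e : NExpr} (hB : e.eval σ ≤ B) (h : Q (σ.setN x (e.eval σ))) :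
    Run B (.nset x e) σ (e.cost + 1) Q := by
  refine fun hb => ⟨_, _, .nset σ x e hB, le_rfl, fun y => ?_, h⟩
  by_cases hy : y = x
  · simpa [Store.setN, hy] using hB
  · simpa [Store.setN, hy] using hb y

lemma Run.nput {a : ℕ} {i e : NExpr} (hB : e.eval σ ≤ B)
    (h : Q (σ.putN a (i.eval σ) (e.eval σ))) :
    Run B (.nput a i e) σ (i.cost + e.cost + 1) Q :=
  fun hb => ⟨_, _, .nput σ a i e hB, le_rfl, hb, h⟩

lemma Run.rset {x : ℕ} {e : RExpr} (h : Q (σ.setR x (e.eval σ))) :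
    Run B (.rset x e) σ (e.cost + 1) Q := fun hb => ⟨_, _, .rset σ x e, le_rfl, hb, h⟩

lemma Run.rput {a : ℕ} {i : NExpr} {e : RExpr} (h : Q (σ.putR a (i.eval σ) (e.eval σ))) :
    Run B (.rput a i e) σ (i.cost + e.cost + 1) Q :=
  fun hb => ⟨_, _, .rput σ a i e, le_rfl, hb, h⟩

lemma Run.seq (h : Run B p σ c₁ fun σ₁ => Run B q σ₁ c₂ Q) :
    Run B (.seq p q) σ (c₁ + c₂) Q := by
  intro hb
  obtain ⟨T, σ₁, hE, hT, hb₁, hq⟩ := h hb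
  obtain ⟨T₂, σ₂, hE₂, hT₂, hb₂, hQ⟩ := hq hb₁
  exact ⟨_, _, .seq hE hE₂, Nat.add_le_add hT hT₂, hb₂, hQ⟩

lemma Run.ite {b : BExpr} (h₁ : b.holds σ → Run B p σ c₁ Q) (h₂ : ¬ b.holds σ → Run B q σ c₂ Q) :
    Run B (.ite b p q) σ (b.cost + 1 + (c₁ + c₂)) Q := by
  intro hB
  by_cases hb : b.holds σ
  · obtain ⟨T, σ', hE, hT, hQ⟩ := h₁ hb hB
    exact ⟨_, _, .ite_true hb hE, by omega, hQ⟩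
  · obtain ⟨T, σ', hE, hT, hQ⟩ := h₂ hb hB
    exact ⟨_, _, .ite_false hb hE, by omega, hQ⟩

/-- A loop with invariant `I`, whose first argument bounds the number of rounds still to come. -/
lemma Run.loop {b : BExpr} {cb : ℕ} (I : ℕ → Store → Prop)
    (hbody : ∀ f σ, I f σ → b.holds σ → ∃ f', f = f' + 1 ∧ Run B p σ cb (I f'))
    (hexit : ∀ f σ, I f σ → ¬ b.holds σ → Q σ) (f : ℕ) :
    ∀ σ, I f σ → Run B (.loop b p) σ (f * (cb + b.cost + 1) + (b.cost + 1)) Q := by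
  induction f with
  | zero =>
    intro σ hI hB
    by_cases hb : b.holds σ
    · obtain ⟨f', hf, -⟩ := hbody 0 σ hI hb
      omega
    · exact ⟨_, _, .loop_done hb, by omega, hB, hexit _ _ hI hb⟩
  | succ f ih =>
    intro σ hI hB
    by_cases hb : b.holds σ
    · obtain ⟨f', hf, h⟩ := hbody _ σ hI hb
      obtain rfl : f = f' := by omega
      obtain ⟨T, σ₁, hE, hT, hB₁, hI'⟩ := h hB
      obtain ⟨T₂, σ₂, hE₂, hT₂, hQ⟩ := ih σ₁ hI' hB₁
      refine ⟨_, _, .loop_step hb hE hE₂, ?_, hQ⟩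
      rw [Nat.succ_mul]
      omega
    · exact ⟨_, _, .loop_done hb, by omega, hB, hexit _ _ hI hb⟩

end

end RealRAM

/-! ### Evacuation of a subpath to one sink -/

namespace PathNetwork

/-- The greedy flow through a chain of vertices joined by edges of capacity `c`: at every vertex the
evacuees leave as early as possible.  The number `W d` is the total weight of the vertices
`0, …, d` of the chain, and `D d` is the time at which its `d`-th vertex is met by a traveller who
does not wait. -/
noncomputable def chainFlow (c : ℝ) (W D : ℕ → ℝ) : ℕ → ℝ → ℝ
  | 0, t => min (c * max t 0) (W 0)
  | d + 1, t => min (c * max t 0) (W (d + 1) - W d + chainFlow c W D d (t - (D (d + 1) - D d)))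

section chain
variable {c : ℝ} {W D : ℕ → ℝ}

lemma chainFlow_nonneg (hc : 0 ≤ c) (hW : Monotone W) (hW0 : 0 ≤ W 0) (d : ℕ) (t : ℝ) :
    0 ≤ chainFlow c W D d t := by
  induction d generalizing t with
  | zero => exact le_min (mul_nonneg hc (le_max_right _ _)) hW0
  | succ d ih =>
    refine le_min (mul_nonneg hc (le_max_right _ _)) ?_
    have h := hW (Nat.le_succ d)
    have := ih (t - (D (d + 1) - D d))
    simp only [Nat.succ_eq_add_one] at h
    linarith

lemma chainFlow_le (d : ℕ) (t : ℝ) : chainFlow c W D d t ≤ c * max t 0 := by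
  cases d <;> exact min_le_left _ _

lemma chainFlow_isInflow (hc : 0 ≤ c) (hW : Monotone W) (hW0 : 0 ≤ W 0) (d : ℕ) :
    IsInflow c (chainFlow c W D d) := by
  refine ⟨fun t ht => le_antisymm ?_ (chainFlow_nonneg hc hW hW0 d t), ?_, ?_⟩
  · simpa [max_eq_right ht] using chainFlow_le (c := c) (W := W) (D := D) d t
  · induction d with
    | zero =>
      intro t t' h
      exact min_le_min (mul_le_mul_of_nonneg_left (max_le_max h le_rfl) hc) le_rfl
    | succ d ih =>
      intro t t' h
      refine min_le_min (mul_le_mul_of_nonneg_left (max_le_max h le_rfl) hc) ?_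
      have := ih (sub_le_sub_right h (D (d + 1) - D d))
      linarith
  · have key : ∀ t t' : ℝ, t ≤ t' → c * max t' 0 ≤ c * max t 0 + c * (t' - t) := by
      intro t t' h
      rw [← mul_add]
      refine mul_le_mul_of_nonneg_left (max_le ?_ ?_) hc <;>
        linarith [le_max_left t 0, le_max_right t 0]
    induction d with
    | zero =>
      intro t t' h
      have h0 := mul_nonneg hc (sub_nonneg.2 h)
      have : chainFlow c W D 0 t' ≤ chainFlow c W D 0 t + c * (t' - t) := by
        simp only [chainFlow]
        rw [← min_add_add_right]
        exact min_le_min (key t t' h) (by linarith)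
      linarith
    | succ d ih =>
      intro t t' h
      have h1 := ih (t - (D (d + 1) - D d)) (t' - (D (d + 1) - D d)) (by linarith)
      have : chainFlow c W D (d + 1) t' ≤ chainFlow c W D (d + 1) t + c * (t' - t) := by
        simp only [chainFlow]
        rw [← min_add_add_right]
        refine min_le_min (key t t' h) ?_
        rw [sub_sub_sub_cancel_right] at h1
        linarith
      linarith

/-- The greedy flow has emptied the chain at time `t` if, for each `i`, the evacuees of the first
`i + 1` vertices fit through the edges in the time they have. -/
lemma chainFlow_eq (hc : 0 ≤ c) (d : ℕ) (t : ℝ)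
    (h : ∀ i, i ≤ d → W i ≤ c * (t - (D d - D i))) : chainFlow c W D d t = W d := by
  have h' : W d ≤ c * max t 0 := by
    have := h d le_rfl
    rw [sub_self, sub_zero] at this
    exact this.trans (mul_le_mul_of_nonneg_left (le_max_left _ _) hc)
  induction d generalizing t with
  | zero => exact min_eq_right h'
  | succ d ih =>
    have hi : ∀ i, i ≤ d → W i ≤ c * (t - (D (d + 1) - D d) - (D d - D i)) := by
      intro i hi
      have := h i (by omega)
      rwa [show t - (D (d + 1) - D d) - (D d - D i) = t - (D (d + 1) - D i) by ring]
    have h1 := ih (t - (D (d + 1) - D d)) hi (by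
      have := hi d le_rfl
      rw [sub_self, sub_zero] at this
      exact this.trans (mul_le_mul_of_nonneg_left (le_max_left _ _) hc))
    rw [chainFlow, h1, sub_add_cancel]
    exact min_eq_right h'

/-- No flow through a chain is faster than the capacity of the edge behind its `i`-th vertex
permits. -/
lemma chain_bound {m : ℕ} {F : ℕ → ℝ → ℝ} (hF : ∀ d, d ≤ m → IsInflow c (F d))
    (hstep : ∀ d, d < m → ∀ t,
      F (d + 1) t ≤ W (d + 1) - W d + F d (t - (D (d + 1) - D d)))
    {i d : ℕ} (hid : i ≤ d) (hd : d ≤ m) (t : ℝ) :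
    F d t ≤ c * max (t - (D d - D i)) 0 + (W d - W i) := by
  induction d, hid using Nat.le_induction generalizing t with
  | base =>
    obtain ⟨h0, -, hlip⟩ := hF i hd
    rw [sub_self, sub_zero, sub_self, add_zero]
    rcases le_total t 0 with ht | ht
    · rw [h0 t ht, max_eq_right ht, mul_zero]
    · have := hlip 0 t ht
      rw [h0 0 le_rfl] at this
      rw [max_eq_left ht]
      linarith
  | succ d hid ih =>
    have h1 := hstep d (by omega) t
    have h2 := ih (by omega) (t - (D (d + 1) - D d))
    rw [show t - (D (d + 1) - D d) - (D d - D i) = t - (D (d + 1) - D i) by ring] at h2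
    linarith

lemma chain_necessary {m : ℕ} {F : ℕ → ℝ → ℝ} (hF : ∀ d, d ≤ m → IsInflow c (F d))
    (hstep : ∀ d, d < m → ∀ t,
      F (d + 1) t ≤ W (d + 1) - W d + F d (t - (D (d + 1) - D d)))
    {t : ℝ} (heq : F m t = W m) {i : ℕ} (hi : i ≤ m) (hWi : 0 < W i) :
    W i ≤ c * (t - (D m - D i)) := by
  have h := chain_bound (D := D) hF hstep hi le_rfl t
  rw [heq] at h
  rcases le_total (t - (D m - D i)) 0 with h0 | h0
  · rw [max_eq_right h0, mul_zero] at h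
    linarith
  · rw [max_eq_left h0] at h
    linarith

end chain

variable {N : PathNetwork}

lemma pos_succ (N : PathNetwork) (i : ℕ) : N.pos (i + 1) = N.pos i + N.len i :=
  Finset.sum_range_succ _ _

lemma sum_Icc_weight_mono (N : PathNetwork) (a : ℕ) :
    Monotone fun d => ∑ i ∈ Finset.Icc a (a + d), (N.weight i : ℝ) := by
  intro d e h
  exact Finset.sum_le_sum_of_subset_of_nonneg (Finset.Icc_subset_Icc_right (by omega))
    fun _ _ _ => Nat.cast_nonneg _

lemma sum_Ico_weight_mono (N : PathNetwork) (b : ℕ) :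
    Monotone fun d => ∑ i ∈ Finset.Ico (b - 1 - d) b, (N.weight i : ℝ) := by
  intro d e h
  exact Finset.sum_le_sum_of_subset_of_nonneg (Finset.Ico_subset_Ico_left (by omega))
    fun _ _ _ => Nat.cast_nonneg _

lemma sum_Icc_weight_succ (N : PathNetwork) {a h : ℕ} (hah : a ≤ h + 1) :
    ∑ i ∈ Finset.Icc a (h + 1), (N.weight i : ℝ) =
      ∑ i ∈ Finset.Icc a h, (N.weight i : ℝ) + N.weight (h + 1) :=
  Finset.sum_Icc_succ_top hah _

lemma sum_Ico_weight_pred (N : PathNetwork) {h b : ℕ} (hb : h < b) :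
    ∑ i ∈ Finset.Ico h b, (N.weight i : ℝ) =
      N.weight h + ∑ i ∈ Finset.Ico (h + 1) b, (N.weight i : ℝ) :=
  Finset.sum_eq_sum_Ico_succ_bot hb _

/-- With uniform capacity `c`, a subpath can be evacuated to `s` within time `T` exactly if for each
vertex on either side, the evacuees who start there or beyond can pass through one edge in the time
left over by the travel from that vertex to the sink. -/
theorem evacuatesWithin_iff {c : ℝ} (hc : ∀ i, i + 1 < N.n → N.cap i = c ∧ 0 < c)
    {a b : ℕ} (hb : b ≤ N.n) {s : N.Point} (hs : s.OnSubpath a b) {T : ℝ} :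
    N.EvacuatesWithin a b s T ↔ 0 ≤ T ∧
      (∀ i, a ≤ i → s.VertexLeft i →
        ∑ j ∈ Finset.Icc a i, (N.weight j : ℝ) ≤ c * (T - (s.pos - N.pos i) * N.τ)) ∧
      (∀ i, i < b → s.VertexRight i →
        ∑ j ∈ Finset.Ico i b, (N.weight j : ℝ) ≤ c * (T - (N.pos i - s.pos) * N.τ)) := by
  obtain ⟨hsa, hsb⟩ := hs
  have hsn := s.idx_lt
  have left_lt : ∀ i, s.VertexLeft i → i < b ∧ i + 1 < N.n := by
    rintro i (hi | ⟨rfl, hi⟩)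
    · omega
    · rcases hsb with h | ⟨-, h⟩
      · omega
      · exact absurd h hi.ne'
  constructor
  · rintro ⟨hT, F, hL, hR⟩
    refine ⟨hT, ?_, ?_⟩
    · intro i hai hi
      obtain ⟨l, hl, hl', hil⟩ : ∃ l, s.VertexLeft l ∧ ¬ s.VertexLeft (l + 1) ∧ i ≤ l := by
        rcases s.off_nonneg.lt_or_eq with h | h
        · exact ⟨s.idx, .inr ⟨rfl, h⟩, by simp [Point.VertexLeft],
            by rcases hi with hi | hi <;> omega⟩
        · rcases hi with hi | ⟨-, hi⟩
          · exact ⟨s.idx - 1, .inl (by omega), by simp [Point.VertexLeft, ← h]; omega, by omega⟩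
          · exact absurd h hi.ne
      have left_of_le : ∀ h, h ≤ l → s.VertexLeft h := by
        intro h hh
        rcases hl with hl | ⟨rfl, hl⟩
        · exact .inl (by omega)
        · rcases hh.lt_or_eq with hh | rfl
          · exact .inl hh
          · exact .inr ⟨rfl, hl⟩
      have key := chain_necessary (c := c) (m := l - a) (i := i - a)
        (F := fun d => F (a + d)) (W := fun d => ∑ i ∈ Finset.Icc a (a + d), (N.weight i : ℝ))
        (D := fun d => N.pos (a + d) * N.τ) (t := T - (s.pos - N.pos l) * N.τ) ?_ ?_ ?_
        (by omega) ?_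
      · simp only [Nat.add_sub_cancel' hai, Nat.add_sub_cancel' (hai.trans hil)] at key
        refine key.trans (le_of_eq ?_)
        ring
      · intro d hd
        have hd' := left_of_le (a + d) (by omega)
        have := (hL (a + d) (by omega) (left_lt _ hd').1 hd').1
        rwa [(hc _ (left_lt _ hd').2).1] at this
      · intro d hd t
        have hd' := left_of_le (a + (d + 1)) (by omega)
        have := (hL (a + (d + 1)) (by omega) (left_lt _ hd').1 hd').2.1 t
        rw [if_pos (by omega), ← add_assoc, Nat.add_sub_cancel] at this
        simp only [← add_assoc]
        rw [sum_Icc_weight_succ N (by omega), pos_succ]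
        convert this using 2
        · ring
        · congr 1; ring
      · have := (hL l (by omega) (left_lt l hl).1 hl).2.2 hl'
        simpa only [Nat.add_sub_cancel' (hai.trans hil)] using this
      · simp only [Nat.add_sub_cancel' hai]
        refine Finset.sum_pos (fun j hj => ?_) ⟨i, by simp [hai]⟩
        have := left_lt i hi
        simp only [Finset.mem_Icc] at hj
        exact Nat.cast_pos.2 (N.weight_pos j (by omega))
    · intro i hib hi
      have hi' : s.idx < i := hi
      have key := chain_necessary (c := c) (m := b - 1 - (s.idx + 1)) (i := b - 1 - i)
        (F := fun d => F (b - 1 - d))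
        (W := fun d => ∑ i ∈ Finset.Ico (b - 1 - d) b, (N.weight i : ℝ))
        (D := fun d => - N.pos (b - 1 - d) * N.τ)
        (t := T - (N.pos (s.idx + 1) - s.pos) * N.τ) ?_ ?_ ?_ (by omega) ?_
      · simp only [show b - 1 - (b - 1 - i) = i by omega,
          show b - 1 - (b - 1 - (s.idx + 1)) = s.idx + 1 by omega] at key
        refine key.trans (le_of_eq ?_)
        ring
      · intro d hd
        have := (hR (b - 1 - d) (by omega) (by omega) (show s.idx < _ by omega)).1
        rwa [(hc _ (by omega)).1] at this
      · intro d hd t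
        obtain ⟨e, he⟩ : ∃ e, b - 1 - (d + 1) = e := ⟨_, rfl⟩
        have he' : b - 1 - d = e + 1 := by omega
        have := (hR e (by omega) (by omega) (show s.idx < _ by omega)).2.1 t
        rw [if_pos (by omega)] at this
        simp only [he, he']
        rw [sum_Ico_weight_pred N (h := e) (by omega), pos_succ]
        convert this using 2
        · ring
        · congr 1; ring
      · have := (hR (s.idx + 1) (by omega) (by omega) (show s.idx < _ by omega)).2.2
          (by simp [Point.VertexRight])
        simpa only [show b - 1 - (b - 1 - (s.idx + 1)) = s.idx + 1 by omega] using this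
      · simp only [show b - 1 - (b - 1 - i) = i by omega]
        refine Finset.sum_pos (fun j hj => ?_) ⟨i, by simp [hib]⟩
        simp only [Finset.mem_Ico] at hj
        exact Nat.cast_pos.2 (N.weight_pos j (by omega))
  · rintro ⟨hT, hL, hR⟩
    classical
    have hWL : ∀ a, 0 ≤ ∑ i ∈ Finset.Icc a (a + 0), (N.weight i : ℝ) := fun a =>
      Finset.sum_nonneg fun _ _ => Nat.cast_nonneg _
    have hWR : ∀ b, 0 ≤ ∑ i ∈ Finset.Ico (b - 1 - 0) b, (N.weight i : ℝ) := fun b =>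
      Finset.sum_nonneg fun _ _ => Nat.cast_nonneg _
    let FL := chainFlow c (fun d => ∑ i ∈ Finset.Icc a (a + d), (N.weight i : ℝ))
      (fun d => N.pos (a + d) * N.τ)
    let FR := chainFlow c (fun d => ∑ i ∈ Finset.Ico (b - 1 - d) b, (N.weight i : ℝ))
      (fun d => - N.pos (b - 1 - d) * N.τ)
    have left_of_le : ∀ i j, i ≤ j → s.VertexLeft j → s.VertexLeft i := by
      rintro i j hij (hj | ⟨rfl, hj⟩)
      · exact .inl (by omega)
      · rcases hij.lt_or_eq with hij | rfl
        · exact .inl hij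
        · exact .inr ⟨rfl, hj⟩
    have right_not : ∀ i, s.VertexRight i → ¬ s.VertexLeft i := by
      rintro i (hi : s.idx < i) (h | ⟨h, -⟩) <;> omega
    refine ⟨hT, fun h => if s.VertexLeft h then FL (h - a) else FR (b - 1 - h), ?_, ?_⟩
    · intro h hah hhb hl
      obtain ⟨d, rfl⟩ := Nat.exists_eq_add_of_le hah
      have hcap := hc _ (left_lt _ hl).2
      beta_reduce
      rw [if_pos hl, Nat.add_sub_cancel_left, hcap.1]
      refine ⟨chainFlow_isInflow hcap.2.le (sum_Icc_weight_mono N a) (hWL a) d, ?_, ?_⟩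
      · intro t
        rcases d with _ | d
        · refine (min_le_right _ _).trans (le_of_eq ?_)
          simp
        · rw [if_pos (by omega), if_pos (left_of_le _ _ (by omega) hl)]
          rw [show a + (d + 1) - 1 - a = d by omega, show a + (d + 1) - 1 = a + d by omega]
          refine (min_le_right _ _).trans (le_of_eq ?_)
          simp only [← add_assoc]
          rw [sum_Icc_weight_succ N (by omega), pos_succ]
          change _ + FL d _ = _ + FL d _
          exact congrArg₂ (· + ·) (by ring) (congrArg _ (by ring))
      · intro _
        refine chainFlow_eq hcap.2.le d _ fun i hi => ?_
        refine (hL (a + i) (by omega) (left_of_le _ _ (by omega) hl)).trans (le_of_eq ?_)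
        ring
    · intro h hah hhb hr
      have hr' : s.idx < h := hr
      obtain ⟨d, hd⟩ : ∃ d, b - 1 - h = d := ⟨_, rfl⟩
      obtain rfl : h = b - 1 - d := by omega
      have hcap := hc (b - 1 - d - 1) (by omega)
      beta_reduce
      rw [if_neg (right_not _ hr), hd, hcap.1]
      refine ⟨chainFlow_isInflow hcap.2.le (sum_Ico_weight_mono N b) (hWR b) d, ?_, ?_⟩
      · intro t
        rcases d with _ | d
        · rw [if_neg (by omega)]
          refine (min_le_right _ _).trans (le_of_eq ?_)
          simp only [Nat.sub_zero]
          rw [sum_Ico_weight_pred N (by omega), Nat.sub_add_cancel (by omega)]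
          simp
        · obtain ⟨e, he⟩ : ∃ e, b - 1 - (d + 1) = e := ⟨_, rfl⟩
          have he' : b - 1 - d = e + 1 := by omega
          rw [if_pos (by omega), if_neg (right_not _ (show s.idx < _ by omega)),
            show b - 1 - (b - 1 - (d + 1) + 1) = d by omega]
          refine (min_le_right _ _).trans (le_of_eq ?_)
          simp only [he, he']
          rw [sum_Ico_weight_pred N (h := e) (by omega), pos_succ]
          change _ + FR d _ = _ + FR d _
          exact congrArg₂ (· + ·) (by ring) (congrArg _ (by ring))
      · intro _
        refine chainFlow_eq hcap.2.le d _ fun i hi => ?_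
        refine (hR (b - 1 - i) (by omega) (show s.idx < _ by omega)).trans (le_of_eq ?_)
        ring

end PathNetwork

/-! ### Maxima over ranges of indices -/

/-- The maximum of `f` over the indices `i` with `a ≤ i < b`; if there is none, `f a`. -/
noncomputable def rangeMax (f : ℕ → ℝ) (a b : ℕ) : ℝ :=
  (insert a (Finset.Ico a b)).sup' (Finset.insert_nonempty _ _) f

lemma rangeMax_le_iff {f : ℕ → ℝ} {a b : ℕ} {t : ℝ} :
    rangeMax f a b ≤ t ↔ f a ≤ t ∧ ∀ i, a ≤ i → i < b → f i ≤ t := by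
  simp [rangeMax, Finset.sup'_le_iff]

lemma rangeMax_le_iff_of_lt {f : ℕ → ℝ} {a b : ℕ} {t : ℝ} (h : a < b) :
    rangeMax f a b ≤ t ↔ ∀ i, a ≤ i → i < b → f i ≤ t :=
  rangeMax_le_iff.trans ⟨fun h => h.2, fun h' => ⟨h' a le_rfl h, h'⟩⟩

lemma le_rangeMax {f : ℕ → ℝ} {a b i : ℕ} (h : a ≤ i) (h' : i < b) : f i ≤ rangeMax f a b :=
  (rangeMax_le_iff.1 le_rfl).2 i h h'

lemma exists_eq_rangeMax (f : ℕ → ℝ) {a b : ℕ} (h : a < b) :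
    ∃ i, a ≤ i ∧ i < b ∧ rangeMax f a b = f i := by
  obtain ⟨i, hi, he⟩ := Finset.exists_mem_eq_sup' (Finset.insert_nonempty a (Finset.Ico a b)) f
  rcases Finset.mem_insert.1 hi with rfl | hi
  · exact ⟨i, le_rfl, h, he⟩
  · exact ⟨i, (Finset.mem_Ico.1 hi).1, (Finset.mem_Ico.1 hi).2, he⟩

lemma rangeMax_self (f : ℕ → ℝ) (a : ℕ) : rangeMax f a a = f a := by simp [rangeMax]

lemma rangeMax_succ (f : ℕ → ℝ) (a : ℕ) : rangeMax f a (a + 1) = f a := by simp [rangeMax]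

lemma max_rangeMax (f : ℕ → ℝ) {a p q : ℕ} (hap : a ≤ p) (hpq : p < q) :
    max (rangeMax f a p) (rangeMax f p q) = rangeMax f a q := by
  refine eq_of_forall_ge_iff fun t => ?_
  rw [max_le_iff, rangeMax_le_iff, rangeMax_le_iff_of_lt hpq,
    rangeMax_le_iff_of_lt (hap.trans_lt hpq)]
  constructor
  · rintro ⟨⟨-, h₁⟩, h₂⟩ i hi hi'
    rcases lt_or_ge i p with h | h
    · exact h₁ i hi h
    · exact h₂ i h hi'
  · intro h
    exact ⟨⟨h a le_rfl (by omega), fun i hi hi' => h i hi (by omega)⟩,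
      fun i hi hi' => h i (by omega) hi'⟩

/-! ### The greedy placement of sinks -/

namespace PathNetwork

/-- The weight of `v_i`, as it is found in the memory. -/
def inWeight (N : PathNetwork) (i : ℕ) : ℝ := if i < N.n then (N.weight i : ℝ) else 0

/-- The length of `e_i`, as it is found in the memory. -/
noncomputable def inLen (N : PathNetwork) (i : ℕ) : ℝ := if i + 1 < N.n then N.len i else 0

/-- The capacity of the first edge, as it is found in the memory.  It is `0` if there is only one
vertex; then all loads are `0` as well, and no threshold is ever compared. -/
noncomputable def inCap (N : PathNetwork) : ℝ := if 1 < N.n then N.cap 0 else 0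

/-- The time that the evacuees of the vertices `v_j`, `j < i`, need for passing through one point
of an edge. -/
noncomputable def load (N : PathNetwork) (i : ℕ) : ℝ :=
  ∑ j ∈ Finset.range i, N.inWeight j / N.inCap

/-- The travel time from `v_0` to `v_i`. -/
noncomputable def travel (N : PathNetwork) (i : ℕ) : ℝ :=
  ∑ j ∈ Finset.range i, N.inLen j * N.τ

/-- The part depending on `i` of the time that the evacuees of the vertices up to `v_i` need for
reaching a sink to the right. -/
noncomputable def keyL (N : PathNetwork) (i : ℕ) : ℝ := N.load (i + 1) - N.travel i

/-- The part depending on `i` of the time that the evacuees of the vertices from `v_i` on need for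
reaching a sink to the left. -/
noncomputable def keyR (N : PathNetwork) (i : ℕ) : ℝ := N.travel i - N.load i

variable {N : PathNetwork}

lemma travel_eq {i : ℕ} (hi : i < N.n) : N.travel i = N.pos i * N.τ := by
  rw [travel, pos, Finset.sum_mul]
  refine Finset.sum_congr rfl fun j hj => ?_
  rw [inLen, if_pos (by simp only [Finset.mem_range] at hj; omega)]

lemma travel_succ (N : PathNetwork) (i : ℕ) :
    N.travel (i + 1) = N.travel i + N.inLen i * N.τ := Finset.sum_range_succ _ _

lemma load_succ (N : PathNetwork) (i : ℕ) :
    N.load (i + 1) = N.load i + N.inWeight i / N.inCap := Finset.sum_range_succ _ _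

lemma travel_mono (N : PathNetwork) : Monotone N.travel := by
  refine monotone_nat_of_le_succ fun i => ?_
  rw [travel_succ]
  have : 0 ≤ N.inLen i := by
    rw [inLen]
    split_ifs with h
    exacts [N.len_nonneg i h, le_rfl]
  nlinarith [N.τ_pos]

lemma load_mono (N : PathNetwork) : Monotone N.load := by
  refine monotone_nat_of_le_succ fun i => ?_
  rw [load_succ, inWeight, inCap]
  have : 0 ≤ (if i < N.n then (N.weight i : ℝ) else 0) / (if 1 < N.n then N.cap 0 else 0) := by
    refine div_nonneg (by split_ifs <;> simp) ?_
    split_ifs with h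
    exacts [(N.cap_pos 0 h).le, le_rfl]
  linarith

lemma load_sub {a b : ℕ} (hab : a ≤ b) (hb : b ≤ N.n) :
    N.load b - N.load a = (∑ j ∈ Finset.Ico a b, (N.weight j : ℝ)) / N.inCap := by
  rw [load, load, ← Finset.sum_Ico_eq_sub _ hab, Finset.sum_div]
  refine Finset.sum_congr rfl fun j hj => ?_
  rw [inWeight, if_pos (by simp only [Finset.mem_Ico] at hj; omega)]

/-- The travel time from `v_0` to a point. -/
noncomputable def Point.time (s : N.Point) : ℝ := s.pos * N.τ

lemma Point.time_eq (s : N.Point) : s.time = N.travel s.idx + s.off * N.τ := by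
  rw [Point.time, Point.pos, travel_eq s.idx_lt, add_mul]

lemma Point.time_le (s : N.Point) : s.time ≤ N.travel (s.idx + 1) := by
  rw [Point.time_eq, travel_succ]
  have h0 := N.τ_pos
  rcases s.off_lt with h | ⟨h, h'⟩
  · have := N.travel_mono (Nat.le_succ s.idx)
    rw [h]
    rw [Nat.succ_eq_add_one, travel_succ] at this
    linarith
  · rw [inLen, if_pos h]
    nlinarith

lemma Point.le_time (s : N.Point) : N.travel s.idx ≤ s.time := by
  rw [Point.time_eq]
  nlinarith [N.τ_pos, s.off_nonneg]

/-- A subpath can be evacuated to `s` within time `T` exactly if every vertex on the two sides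
permits it. -/
lemma IsUniform.evacuatesWithin_iff (hU : N.IsUniform) {a b : ℕ} (hb : b ≤ N.n) {s : N.Point}
    (hs : s.OnSubpath a b) {T : ℝ} :
    N.EvacuatesWithin a b s T ↔ 0 ≤ T ∧
      (∀ i, a ≤ i → s.VertexLeft i → N.keyL i - N.load a + s.time ≤ T) ∧
      (∀ i, i < b → s.VertexRight i → N.keyR i + N.load b - s.time ≤ T) := by
  have hcap : ∀ i, i + 1 < N.n → N.cap i = N.inCap ∧ 0 < N.inCap := by
    intro i hi
    rw [inCap, if_pos (by omega)]
    exact ⟨hU _ _ hi (by omega), N.cap_pos _ (by omega)⟩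
  rw [PathNetwork.evacuatesWithin_iff hcap hb hs]
  have hsn := s.idx_lt
  refine and_congr_right fun _ => and_congr ?_ ?_
  · refine forall_congr' fun i => forall_congr' fun hai => forall_congr' fun hi => ?_
    have hin : i + 1 < N.n := by
      rcases hi with hi | ⟨rfl, hi⟩
      · omega
      · rcases hs.2 with h | ⟨-, h⟩
        · omega
        · exact absurd h hi.ne'
    have h := load_sub (N := N) (a := a) (b := i + 1) (by omega) (by omega)
    rw [keyL, travel_eq (by omega), Point.time, ← div_le_iff₀' (hcap i hin).2,
      show Finset.Icc a i = Finset.Ico a (i + 1) from by ext; simp, ← h]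
    constructor <;> intro h <;> linarith
  · refine forall_congr' fun i => forall_congr' fun hib => forall_congr' fun hi => ?_
    have hi' : s.idx < i := hi
    have h := load_sub (N := N) (a := i) (b := b) (by omega) (by omega)
    rw [keyR, travel_eq (by omega), Point.time, ← div_le_iff₀' (hcap 0 (by omega)).2, ← h]
    constructor <;> intro h <;> linarith

/-- The least time in which the evacuees of `v_a, …, v_{h-1}` can reach `v_h`, for `a < h`. -/
noncomputable def leftTime (N : PathNetwork) (a h : ℕ) : ℝ :=
  rangeMax N.keyL a h + N.travel h - N.load a

/-- For `a ≤ h` and `h + 1 < b`, the least time in which the evacuees of `v_{h+1}, …, v_{b-1}` can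
reach a sink that is as far to the right of `v_h` as the evacuees of `v_a, …, v_h` can go in the same
time, or at `v_h` if they cannot go beyond.  The two terms belong to a sink at `v_h` and to a sink
that the evacuees from both sides reach at the same time. -/
noncomputable def rightTime (N : PathNetwork) (a h b : ℕ) : ℝ :=
  min (rangeMax N.keyR (h + 1) b + N.load b - N.travel h)
    ((rangeMax N.keyR (h + 1) b + N.load b + rangeMax N.keyL a (h + 1) - N.load a) / 2)

/-- In time `t`, the evacuees of `v_a, v_{a+1}, …` can be brought together as far right as `v_h` but
not `v_{h+1}`, and a sink so chosen can serve the vertices `v_i`, `a ≤ i < b`, but not `v_b`. -/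
structure GreedyStep (N : PathNetwork) (t : ℝ) (a h b : ℕ) : Prop where
  le : a ≤ h
  lt : h < b
  le_n : b ≤ N.n
  left : h = a ∨ N.leftTime a h ≤ t
  left_max : h + 1 < N.n → t < N.leftTime a (h + 1)
  right : b = h + 1 ∨ N.rightTime a h b ≤ t
  right_max : b + 1 ≤ N.n → t < N.rightTime a h (b + 1)

/-- The offset of the sink chosen by a greedy step. -/
noncomputable def greedyOff (N : PathNetwork) (t : ℝ) (a h b : ℕ) : ℝ :=
  if h + 1 < b then
    max 0 ((t + N.load a - rangeMax N.keyL a (h + 1) - N.travel h) / N.τ)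
  else 0

/-- The sink with index `idx` and offset `off` serves the vertices `v_h`, `a ≤ h < b`. -/
def Serves (N : PathNetwork) (t : ℝ) (a b idx : ℕ) (off : ℝ) : Prop :=
  ∃ s : N.Point, s.idx = idx ∧ s.off = off ∧
    (a < b → s.OnSubpath a b ∧ N.EvacuatesWithin a b s t)

/-- The first `j` of the sinks with indices `idx` and offsets `off` serve the vertices `v_h`,
`h < b`. -/
inductive Covers (N : PathNetwork) (t : ℝ) (idx : ℕ → ℕ) (off : ℕ → ℝ) : ℕ → ℕ → Prop
  | zero : Covers N t idx off 0 0
  | succ {j a b : ℕ} : Covers N t idx off j a → a ≤ b → N.Serves t a b (idx j) (off j) →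
      Covers N t idx off (j + 1) b

/-- The greedy placement for time `t` serves the vertices `v_h`, `h < a`, with `j` sinks. -/
inductive Greedy (N : PathNetwork) (t : ℝ) : ℕ → ℕ → Prop
  | zero : Greedy N t 0 0
  | step {j a h b : ℕ} : Greedy N t j a → a < N.n → GreedyStep N t a h b → Greedy N t (j + 1) b
  | done {j : ℕ} : Greedy N t j N.n → Greedy N t (j + 1) N.n

lemma Greedy.le_n {t : ℝ} {j a : ℕ} (h : N.Greedy t j a) : a ≤ N.n := by
  cases h with
  | zero => exact Nat.zero_le _
  | step _ _ h => exact h.le_n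
  | done => exact le_rfl

lemma GreedyStep.serves (hU : N.IsUniform) {t : ℝ} (ht : 0 ≤ t) {a h b : ℕ}
    (hg : N.GreedyStep t a h b) : N.Serves t a b h (N.greedyOff t a h b) := by
  have hτ := N.τ_pos
  have h1 := hg.le
  have h2 := hg.lt
  have h3 := hg.le_n
  set off := N.greedyOff t a h b with hoff
  have hpos : 0 ≤ off := by
    rw [hoff, greedyOff]
    split_ifs
    exacts [le_max_left _ _, le_rfl]
  -- A positive offset moves the sink exactly as far as the evacuees from the left can go.
  have hoff' : 0 < off → h + 1 < b ∧
      N.travel h + off * N.τ = t + N.load a - rangeMax N.keyL a (h + 1) := by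
    rw [hoff, greedyOff]
    split_ifs with hb
    · intro h0
      rcases le_total ((t + N.load a - rangeMax N.keyL a (h + 1) - N.travel h) / N.τ) 0 with h' | h'
      · rw [max_eq_left h'] at h0
        exact absurd h0 (lt_irrefl _)
      · rw [max_eq_right h', div_mul_cancel₀ _ hτ.ne']
        exact ⟨hb, by ring⟩
    · intro h0
      exact absurd h0 (lt_irrefl _)
  have hlen : off = 0 ∨ (h + 1 < N.n ∧ off < N.len h) := by
    rcases hpos.lt_or_eq with h0 | h0
    · obtain ⟨hb, he⟩ := hoff' h0
      have hn : h + 1 < N.n := by omega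
      have := hg.left_max hn
      rw [leftTime, travel_succ, inLen, if_pos hn] at this
      exact .inr ⟨hn, lt_of_mul_lt_mul_right (by linarith) hτ.le⟩
    · exact .inl h0.symm
  let s : N.Point := ⟨h, off, by omega, hpos, hlen⟩
  have hs : s.OnSubpath a b := by
    refine ⟨h1, ?_⟩
    rcases hpos.lt_or_eq with h0 | h0
    · exact .inl (hoff' h0).1
    · rcases (Nat.succ_le_of_lt h2).lt_or_eq with h' | h'
      · exact .inl h'
      · exact .inr ⟨h', h0.symm⟩
  refine ⟨s, rfl, rfl, fun _ => ⟨hs, (hU.evacuatesWithin_iff h3 hs).2 ⟨ht, ?_, ?_⟩⟩⟩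
  · intro i hai hi
    rw [Point.time_eq]
    change N.keyL i - N.load a + (N.travel h + off * N.τ) ≤ t
    rcases hpos.lt_or_eq with h0 | h0
    · rw [(hoff' h0).2]
      have : N.keyL i ≤ rangeMax N.keyL a (h + 1) :=
        le_rangeMax hai (by
          rcases hi with hi | ⟨hi, -⟩ <;> change i < _ at * <;> simp_all [s]; omega)
      linarith
    · have hih : i < h := by
        rcases hi with hi | ⟨-, hi⟩
        · exact hi
        · exact absurd h0 hi.ne
      have : N.keyL i ≤ rangeMax N.keyL a h := le_rangeMax hai hih
      rcases hg.left with h' | h'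
      · omega
      · rw [leftTime] at h'
        rw [← h0]
        linarith
  · intro i hib hi
    have hi' : h < i := hi
    rw [Point.time_eq]
    change N.keyR i + N.load b - (N.travel h + off * N.τ) ≤ t
    have hle : N.keyR i ≤ rangeMax N.keyR (h + 1) b := le_rangeMax hi' hib
    have hb : h + 1 < b := by omega
    have hofft : N.travel h + off * N.τ =
        max (N.travel h) (t + N.load a - rangeMax N.keyL a (h + 1)) := by
      rw [hoff, greedyOff, if_pos hb, max_mul_of_nonneg _ _ hτ.le, div_mul_cancel₀ _ hτ.ne',
        zero_mul, ← max_add_add_left, add_zero]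
      congr 1
      ring
    rw [hofft]
    rcases hg.right with h' | h'
    · omega
    · rw [rightTime, min_le_iff] at h'
      rcases h' with h' | h'
      · linarith [le_max_left (N.travel h) (t + N.load a - rangeMax N.keyL a (h + 1))]
      · linarith [le_max_right (N.travel h) (t + N.load a - rangeMax N.keyL a (h + 1))]

/-- No sink serves vertices beyond those served by the greedy choice, even if it has fewer vertices
to serve on the left. -/
lemma GreedyStep.max (hU : N.IsUniform) {t : ℝ} {a h b x y : ℕ} (hg : N.GreedyStep t a h b)
    (hxa : x ≤ a) (hy : y ≤ N.n) {s : N.Point} (hs : s.OnSubpath x y)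
    (hE : N.EvacuatesWithin x y s t) : y ≤ b := by
  obtain ⟨-, hL, hR⟩ := (hU.evacuatesWithin_iff hy hs).1 hE
  have h1 := hg.le
  have h2 := hg.lt
  have hsn := s.idx_lt
  by_contra! hby
  have hleft : ∀ i, a ≤ i → s.VertexLeft i → N.keyL i - N.load a + s.time ≤ t := by
    intro i hi hi'
    have := hL i (by omega) hi'
    have := N.load_mono hxa
    linarith
  -- The sink cannot lie at `v_{h+1}` or beyond.
  have hidx : s.idx ≤ h := by
    by_contra! hh
    have h3 := hg.left_max (by omega)
    have h4 : rangeMax N.keyL a (h + 1) ≤ t + N.load a - s.time := by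
      refine (rangeMax_le_iff_of_lt (by omega)).2 fun i hi hi' => ?_
      have := hleft i hi (.inl (by omega))
      linarith
    have h5 := N.travel_mono hh
    have h6 := s.le_time
    rw [leftTime] at h3
    simp only [Nat.succ_eq_add_one] at h5
    linarith
  have h3 := hg.right_max (by omega)
  rw [rightTime, lt_min_iff] at h3
  have hK : rangeMax N.keyR (h + 1) (b + 1) + N.load (b + 1) ≤ t + s.time := by
    obtain ⟨i, hi, hi', he⟩ := exists_eq_rangeMax N.keyR (show h + 1 < b + 1 by omega)
    have h4 := hR i (by omega) (show s.idx < i by omega)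
    have h5 := N.load_mono (show b + 1 ≤ y by omega)
    rw [he]
    linarith
  rcases le_or_gt s.time (N.travel h) with hst | hst
  · linarith [h3.1]
  · have hsh : s.VertexLeft h := by
      have hidx' : s.idx = h := by
        refine le_antisymm hidx ?_
        by_contra! hh
        have h4 := N.travel_mono (show s.idx + 1 ≤ h by omega)
        have h5 := s.time_le
        linarith
      refine .inr ⟨hidx'.symm, lt_of_le_of_ne s.off_nonneg fun h0 => ?_⟩
      rw [Point.time_eq, ← h0, hidx'] at hst
      linarith
    have h4 : rangeMax N.keyL a (h + 1) ≤ t + N.load a - s.time := by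
      refine (rangeMax_le_iff_of_lt (by omega)).2 fun i hi hi' => ?_
      have hsi : s.VertexLeft i := by
        rcases hsh with h' | ⟨h', h''⟩
        · exact .inl (by omega)
        · rcases (show i = h ∨ i < h by omega) with rfl | hlt
          · exact .inr ⟨h', h''⟩
          · exact .inl (by omega)
      have := hleft i hi hsi
      linarith
    linarith [h3.2]

/-- The greedy placement stays ahead of every other one. -/
lemma Covers.le_greedy (hU : N.IsUniform) {t : ℝ} {idx : ℕ → ℕ} {off : ℕ → ℝ} {j y : ℕ}
    (hc : N.Covers t idx off j y) :
    y ≤ N.n → ∀ a, N.Greedy t j a → y ≤ a := by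
  induction hc with
  | zero => intros; exact Nat.zero_le _
  | @succ j x y _ hxy hserv ih =>
    intro hy a hg
    cases hg with
    | @step _ a' h _ hg ha hstep =>
      have hxa := ih (by omega) _ hg
      rcases le_or_gt y a' with h' | h'
      · exact h'.trans (hstep.le.trans hstep.lt.le)
      · obtain ⟨s, -, -, hs⟩ := hserv
        obtain ⟨hs1, hs2⟩ := hs (by omega)
        exact hstep.max hU hxa hy hs1 hs2
    | done _ => exact hy

lemma Covers.congr {t : ℝ} {idx idx' : ℕ → ℕ} {off off' : ℕ → ℝ} {j y : ℕ}
    (hc : N.Covers t idx off j y) (h : ∀ i, i < j → idx' i = idx i ∧ off' i = off i) :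
    N.Covers t idx' off' j y := by
  induction hc with
  | zero => exact .zero
  | @succ j x y _ hxy hserv ih =>
    refine .succ (ih fun i hi => h i (by omega)) hxy ?_
    rwa [(h j (by omega)).1, (h j (by omega)).2]

lemma serves_empty (N : PathNetwork) (t : ℝ) (a : ℕ) : N.Serves t a a 0 0 :=
  ⟨⟨0, 0, N.n_pos, le_rfl, .inl rfl⟩, rfl, rfl, fun h => absurd h (lt_irrefl _)⟩

lemma Greedy.exists_covers (hU : N.IsUniform) {t : ℝ} (ht : 0 ≤ t) {j a : ℕ}
    (hg : N.Greedy t j a) : ∃ idx off, N.Covers t idx off j a := by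
  classical
  have extend : ∀ {j x y i : ℕ} {o : ℝ}, (∃ idx off, N.Covers t idx off j x) → x ≤ y →
      N.Serves t x y i o → ∃ idx off, N.Covers t idx off (j + 1) y := by
    rintro j x y i o ⟨idx, off, hc⟩ hxy hs
    refine ⟨Function.update idx j i, Function.update off j o, .succ (hc.congr ?_) hxy ?_⟩
    · intro e he
      simp [he.ne]
    · simpa using hs
  induction hg with
  | zero => exact ⟨fun _ => 0, fun _ => 0, .zero⟩
  | step _ _ hstep ih => exact extend ih (hstep.le.trans hstep.lt.le) (hstep.serves hU ht)
  | done _ ih => exact extend ih le_rfl (serves_empty N t _)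

lemma Covers.sinksEvacuate {t : ℝ} {idx : ℕ → ℕ} {off : ℕ → ℝ} {k : ℕ}
    (hc : N.Covers t idx off k N.n) :
    ∃ S : Fin k → N.Point, (∀ j : Fin k, idx j = (S j).idx ∧ off j = (S j).off) ∧
      N.SinksEvacuate S t := by
  suffices H : ∀ {k m}, N.Covers t idx off k m → ∃ (S : ℕ → N.Point) (β : ℕ → ℕ),
      (∀ j, j < k → idx j = (S j).idx ∧ off j = (S j).off) ∧ Monotone β ∧ β 0 = 0 ∧
      (∀ j, k ≤ j → β j = m) ∧
      ∀ j, j < k → β j < β (j + 1) →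
        (S j).OnSubpath (β j) (β (j + 1)) ∧ N.EvacuatesWithin (β j) (β (j + 1)) (S j) t by
    obtain ⟨S, β, h1, h2, h3, h4, h5⟩ := H hc
    exact ⟨fun j => S j, fun j => h1 j j.2, β, h2, h3, h4 k le_rfl, fun j => h5 j j.2⟩
  intro k m hc
  induction hc with
  | zero =>
    exact ⟨fun _ => ⟨0, 0, N.n_pos, le_rfl, .inl rfl⟩, fun _ => 0, by simp, monotone_const, rfl,
      by simp, by simp⟩
  | @succ j x y _ hxy hserv ih =>
    obtain ⟨S, β, h1, h2, h3, h4, h5⟩ := ih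
    obtain ⟨s, hs1, hs2, hs3⟩ := hserv
    refine ⟨fun i => if i < j then S i else s, fun i => if i ≤ j then β i else y,
      ?_, ?_, ?_, ?_, ?_⟩
    · intro i hi
      beta_reduce
      split_ifs with h
      · exact h1 i h
      · obtain rfl : i = j := by omega
        exact ⟨hs1.symm, hs2.symm⟩
    · intro i i' hi
      beta_reduce
      split_ifs with ha hb hb
      · exact h2 hi
      · exact (h2 ha).trans ((h4 j le_rfl).le.trans hxy)
      · omega
      · exact le_rfl
    · simpa using h3
    · intro i hi
      exact if_neg (by omega)
    · intro i hi
      beta_reduce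
      rcases (show i < j ∨ i = j by omega) with h | rfl
      · rw [if_pos h, if_pos (show i ≤ j by omega), if_pos (show i + 1 ≤ j by omega)]
        exact h5 i h
      · rw [if_neg (lt_irrefl _), if_pos le_rfl, if_neg (show ¬ i + 1 ≤ i by omega),
          h4 i le_rfl]
        exact hs3

lemma SinksEvacuate.exists_covers {t : ℝ} {k : ℕ} {S : Fin k → N.Point}
    (h : N.SinksEvacuate S t) : ∃ idx off, N.Covers t idx off k N.n := by
  obtain ⟨β, hβ, h0, hk, hS⟩ := h
  refine ⟨fun j => if h : j < k then (S ⟨j, h⟩).idx else 0,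
    fun j => if h : j < k then (S ⟨j, h⟩).off else 0, ?_⟩
  rw [← hk]
  suffices H : ∀ j, j ≤ k → N.Covers t (fun j => if h : j < k then (S ⟨j, h⟩).idx else 0)
      (fun j => if h : j < k then (S ⟨j, h⟩).off else 0) j (β j) from H k le_rfl
  intro j
  induction j with
  | zero => intro _; rw [h0]; exact .zero
  | succ j ih =>
    intro hj
    have hj' : j < k := hj
    refine .succ (ih (by omega)) (hβ (Nat.le_succ j)) ?_
    rw [dif_pos hj', dif_pos hj']
    exact ⟨S ⟨j, hj'⟩, rfl, rfl, hS ⟨j, hj'⟩⟩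

/-- The greedy placement decides feasibility: if it succeeds, its sinks are a witness, and no other
placement serves more vertices. -/
theorem Greedy.eq_n_iff (hU : N.IsUniform) {t : ℝ} (ht : 0 ≤ t) {k a : ℕ}
    (hg : N.Greedy t k a) : a = N.n ↔ N.Feasible t k := by
  constructor
  · rintro rfl
    obtain ⟨idx, off, hc⟩ := hg.exists_covers hU ht
    obtain ⟨S, -, hS⟩ := hc.sinksEvacuate
    exact ⟨S, hS⟩
  · rintro ⟨S, hS⟩
    obtain ⟨idx, off, hc⟩ := hS.exists_covers
    exact le_antisymm hg.le_n (hc.le_greedy hU le_rfl _ hg)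

lemma Feasible.nonneg {t : ℝ} {k : ℕ} (h : N.Feasible t k) : 0 ≤ t := by
  obtain ⟨S, β, hβ, h0, hk, hS⟩ := h
  have hn := N.n_pos
  by_contra! ht
  have : ∀ j, j ≤ k → β j = 0 := by
    intro j
    induction j with
    | zero => intro _; exact h0
    | succ j ih =>
      intro hj
      by_contra hne
      have h1 := ih (by omega)
      exact absurd (hS ⟨j, hj⟩ (by simp only; omega)).2.1 (not_le.2 ht)
  have := this k le_rfl
  omega

lemma Feasible.mono (hU : N.IsUniform) {t t' : ℝ} (htt : t ≤ t') {k : ℕ} (h : N.Feasible t k) :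
    N.Feasible t' k := by
  obtain ⟨S, β, hβ, h0, hk, hS⟩ := h
  refine ⟨S, β, hβ, h0, hk, fun j hj => ⟨(hS j hj).1, ?_⟩⟩
  have hb : β (j + 1) ≤ N.n := hk ▸ hβ j.2
  obtain ⟨h1, h2, h3⟩ := (hU.evacuatesWithin_iff hb (hS j hj).1).1 (hS j hj).2
  exact (hU.evacuatesWithin_iff hb (hS j hj).1).2 ⟨h1.trans htt,
    fun i hi hi' => (h2 i hi hi').trans htt, fun i hi hi' => (h3 i hi hi').trans htt⟩

/-- One sink at `v_0` suffices for a certain time. -/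
lemma feasible_load_add_travel (hU : N.IsUniform) {k : ℕ} (hk : 1 ≤ k) :
    N.Feasible (N.load N.n + N.travel N.n) k := by
  have hn := N.n_pos
  have hl0 : N.load 0 = 0 := by simp [load]
  have ht0 : N.travel 0 = 0 := by simp [travel]
  have hl := fun i => N.load_mono (Nat.zero_le i)
  have ht := fun i => N.travel_mono (Nat.zero_le i)
  let s : N.Point := ⟨0, 0, hn, le_rfl, .inl rfl⟩
  refine ⟨fun _ => s, fun j => if j = 0 then 0 else N.n, ?_, rfl, if_neg (by omega), ?_⟩
  · intro i j hij
    beta_reduce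
    split_ifs <;> omega
  · intro j hj
    have hj0 : (j : ℕ) = 0 := by
      by_contra h
      simp [h] at hj
    simp only [hj0, zero_add, one_ne_zero, if_true, if_false]
    have hs : s.OnSubpath 0 N.n := by
      refine ⟨le_rfl, ?_⟩
      rcases (show 0 + 1 < N.n ∨ 0 + 1 = N.n by omega) with h | h
      exacts [.inl h, .inr ⟨h, rfl⟩]
    refine ⟨hs, (hU.evacuatesWithin_iff le_rfl hs).2 ⟨?_, ?_, ?_⟩⟩
    · linarith [hl N.n, ht N.n]
    · rintro i - (hi | ⟨-, hi⟩)
      · exact absurd hi (Nat.not_lt_zero _)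
      · exact absurd hi (lt_irrefl _)
    · intro i hi _
      have := N.travel_mono hi.le
      rw [keyR, Point.time_eq]
      change _ - (N.travel 0 + 0 * N.τ) ≤ _
      rw [ht0]
      linarith [hl i]

end PathNetwork

/-! ### The memory during the computation -/

/-! The word variables with saved values and the real variables from `10` on are left alone by a
greedy step for a given time: `rTime` is that time, and `rLo` and `rHi` are the bounds of the
parametric search.  During a search, `wPos` is the place reached, `wStep` the length of the next
block, `wFlag` the outcome of the last comparison, `rMax` the maximum up to the place reached, `rNew`
the maximum up to the end of the next block, and `rThr` the threshold to be compared.  In a greedy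
step, `wStart` is the first vertex to serve, `wCount` the number of sinks placed before, `wSink` the
index of the sink, and `rLeft` the maximum of `keyL` over the vertices from `wStart` to `wSink`.  The
real arrays `aLoad` and `aTravel` hold the two sequences of these names, and `aKeyL` and `aKeyR` the
trees of maxima. -/

local notation "wN" => (0 : ℕ)
local notation "wK" => (1 : ℕ)
local notation "wSize" => (2 : ℕ)
local notation "wPos" => (3 : ℕ)
local notation "wStep" => (4 : ℕ)
local notation "wFlag" => (5 : ℕ)
local notation "wStart" => (6 : ℕ)
local notation "wCount" => (7 : ℕ)
local notation "wSink" => (8 : ℕ)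
local notation "wIndex" => (9 : ℕ)
local notation "wPosSaved" => (13 : ℕ)
local notation "wStepSaved" => (14 : ℕ)
local notation "wStartSaved" => (16 : ℕ)
local notation "wCountSaved" => (17 : ℕ)
local notation "wSinkSaved" => (18 : ℕ)

local notation "rTau" => (0 : ℕ)
local notation "rMax" => (1 : ℕ)
local notation "rNew" => (2 : ℕ)
local notation "rThr" => (3 : ℕ)
local notation "rLeft" => (4 : ℕ)
local notation "rMaxSaved" => (21 : ℕ)
local notation "rNewSaved" => (22 : ℕ)
local notation "rLeftSaved" => (24 : ℕ)
local notation "rTime" => (10 : ℕ)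
local notation "rLo" => (11 : ℕ)
local notation "rHi" => (12 : ℕ)

local notation "aWeight" => (0 : ℕ)
local notation "aLen" => (1 : ℕ)
local notation "aCap" => (2 : ℕ)
local notation "aLoad" => (4 : ℕ)
local notation "aTravel" => (5 : ℕ)
local notation "aKeyL" => (6 : ℕ)
local notation "aKeyR" => (7 : ℕ)

namespace RealRAM

section
variable (σ : Store) (x y a b i j v : ℕ) (u : ℝ)

@[simp] lemma Store.setN_nvar : (σ.setN x v).nvar y = if y = x then v else σ.nvar y := by
  simp [Store.setN, Function.update_apply]

@[simp] lemma Store.setN_rvar : (σ.setN x v).rvar = σ.rvar := rfl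

@[simp] lemma Store.setN_narr : (σ.setN x v).narr = σ.narr := rfl

@[simp] lemma Store.setN_rarr : (σ.setN x v).rarr = σ.rarr := rfl

@[simp] lemma Store.setR_rvar : (σ.setR x u).rvar y = if y = x then u else σ.rvar y := by
  simp [Store.setR, Function.update_apply]

lemma Store.setR_setR (w : ℝ) : (σ.setR x u).setR x w = σ.setR x w := by
  simp [Store.setR]

@[simp] lemma Store.setR_nvar : (σ.setR x u).nvar = σ.nvar := rfl

@[simp] lemma Store.setR_narr : (σ.setR x u).narr = σ.narr := rfl

@[simp] lemma Store.setR_rarr : (σ.setR x u).rarr = σ.rarr := rfl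

@[simp] lemma Store.putN_narr : (σ.putN a i v).narr b j =
    if b = a then if j = i then v else σ.narr a j else σ.narr b j := by
  by_cases h : b = a
  · subst h; simp [Store.putN, Function.update_apply]
  · simp [Store.putN, h]

@[simp] lemma Store.putN_nvar : (σ.putN a i v).nvar = σ.nvar := rfl

@[simp] lemma Store.putN_rvar : (σ.putN a i v).rvar = σ.rvar := rfl

@[simp] lemma Store.putN_rarr : (σ.putN a i v).rarr = σ.rarr := rfl

@[simp] lemma Store.putR_rarr : (σ.putR a i u).rarr b j =
    if b = a then if j = i then u else σ.rarr a j else σ.rarr b j := by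
  by_cases h : b = a
  · subst h; simp [Store.putR, Function.update_apply]
  · simp [Store.putR, h]

@[simp] lemma Store.putR_nvar : (σ.putR a i u).nvar = σ.nvar := rfl

@[simp] lemma Store.putR_rvar : (σ.putR a i u).rvar = σ.rvar := rfl

@[simp] lemma Store.putR_narr : (σ.putR a i u).narr = σ.narr := rfl

end

/-- The two memories differ at most in the variables that a search uses: the word variables
`3, …, 9` and the real variables `1, …, 9`. -/
structure Agree (σ σ' : Store) : Prop where
  nvar : ∀ x, x < 3 ∨ 10 ≤ x → σ'.nvar x = σ.nvar x
  rvar : ∀ x, x = 0 ∨ 10 ≤ x → σ'.rvar x = σ.rvar x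
  narr : σ'.narr = σ.narr
  rarr : σ'.rarr = σ.rarr

lemma Agree.refl (σ : Store) : Agree σ σ := ⟨fun _ _ => rfl, fun _ _ => rfl, rfl, rfl⟩

lemma Agree.trans {σ σ' σ'' : Store} (h : Agree σ σ') (h' : Agree σ' σ'') : Agree σ σ'' :=
  ⟨fun x hx => (h'.nvar x hx).trans (h.nvar x hx), fun x hx => (h'.rvar x hx).trans (h.rvar x hx),
    h'.narr.trans h.narr, h'.rarr.trans h.rarr⟩

lemma Agree.setN {σ σ' : Store} (h : Agree σ σ') {x v : ℕ} (hx : 3 ≤ x ∧ x < 10) :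
    Agree σ (σ'.setN x v) :=
  ⟨fun y hy => by rw [Store.setN_nvar, if_neg (by omega), h.nvar y hy], h.rvar, h.narr, h.rarr⟩

lemma Agree.setR {σ σ' : Store} (h : Agree σ σ') {x : ℕ} {v : ℝ} (hx : 1 ≤ x ∧ x < 10) :
    Agree σ (σ'.setR x v) :=
  ⟨h.nvar, fun y hy => by rw [Store.setR_rvar, if_neg (by omega), h.rvar y hy], h.narr, h.rarr⟩

/-- The two memories differ at most in the variables that a search uses, in the word arrays and in
the real array `3`. -/
structure AgreeOut (σ σ' : Store) : Prop where
  nvar : ∀ x, x < 3 ∨ 10 ≤ x → σ'.nvar x = σ.nvar x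
  rvar : ∀ x, x = 0 ∨ 10 ≤ x → σ'.rvar x = σ.rvar x
  rarr : ∀ a, a ≠ 3 → σ'.rarr a = σ.rarr a

lemma Agree.agreeOut {σ σ' : Store} (h : Agree σ σ') : AgreeOut σ σ' :=
  ⟨h.nvar, h.rvar, fun _ _ => by rw [h.rarr]⟩

lemma AgreeOut.trans {σ σ' σ'' : Store} (h : AgreeOut σ σ') (h' : AgreeOut σ' σ'') :
    AgreeOut σ σ'' :=
  ⟨fun x hx => (h'.nvar x hx).trans (h.nvar x hx), fun x hx => (h'.rvar x hx).trans (h.rvar x hx),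
    fun a ha => (h'.rarr a ha).trans (h.rarr a ha)⟩

/-- The variables in which a search keeps its state, except for the outcome of the last comparison
and the threshold compared, have the same values in the two memories. -/
structure Keep (σ σ' : Store) : Prop where
  pos : σ'.nvar wPos = σ.nvar wPos
  step : σ'.nvar wStep = σ.nvar wStep
  start : σ'.nvar wStart = σ.nvar wStart
  count : σ'.nvar wCount = σ.nvar wCount
  sink : σ'.nvar wSink = σ.nvar wSink
  max : σ'.rvar rMax = σ.rvar rMax
  new : σ'.rvar rNew = σ.rvar rNew
  left : σ'.rvar rLeft = σ.rvar rLeft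

/-- The variables that a search uses but does not change have the same values in the two
memories. -/
structure Frame (σ σ' : Store) : Prop where
  start : σ'.nvar wStart = σ.nvar wStart
  count : σ'.nvar wCount = σ.nvar wCount
  sink : σ'.nvar wSink = σ.nvar wSink
  left : σ'.rvar rLeft = σ.rvar rLeft

lemma Keep.frame {σ σ' : Store} (h : Keep σ σ') : Frame σ σ' := ⟨h.start, h.count, h.sink, h.left⟩

lemma Frame.trans {σ σ' σ'' : Store} (h : Frame σ σ') (h' : Frame σ' σ'') : Frame σ σ'' :=
  ⟨h'.start.trans h.start, h'.count.trans h.count, h'.sink.trans h.sink, h'.left.trans h.left⟩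

end RealRAM

/-- The array `d` holds the complete binary tree over the blocks of `2 ^ K` values of `f`: the root
has the index `1`, the children of the node `v` the indices `2 v` and `2 v + 1`, the leaf for `i` the
index `2 ^ K + i`, and every node holds the maximum of its block. -/
def IsMaxTree (f : ℕ → ℝ) (K : ℕ) (d : ℕ → ℝ) : Prop :=
  ∀ j r, j ≤ K → r < 2 ^ (K - j) → d (2 ^ (K - j) + r) = rangeMax f (r * 2 ^ j) ((r + 1) * 2 ^ j)

lemma IsMaxTree.get {f : ℕ → ℝ} {K : ℕ} {d : ℕ → ℝ} (h : IsMaxTree f K d) {j r : ℕ} (hj : j ≤ K)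
    (hr : r * 2 ^ j < 2 ^ K) :
    d ((2 ^ K + r * 2 ^ j) / 2 ^ j) = rangeMax f (r * 2 ^ j) ((r + 1) * 2 ^ j) := by
  have hK : 2 ^ K = 2 ^ (K - j) * 2 ^ j := by rw [← pow_add, Nat.sub_add_cancel hj]
  rw [hK, ← add_mul, Nat.mul_div_cancel _ (by positivity)]
  rw [hK] at hr
  exact h j r hj (Nat.lt_of_mul_lt_mul_right hr)

lemma IsMaxTree.leaf {f : ℕ → ℝ} {K : ℕ} {d : ℕ → ℝ} (h : IsMaxTree f K d) {i : ℕ}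
    (hi : i < 2 ^ K) : d (2 ^ K + i) = f i := by
  have := h.get (j := 0) (r := i) (Nat.zero_le _) (by simpa using hi)
  simpa [rangeMax_succ] using this

open RealRAM

namespace PathNetwork

/-- The part of the memory that does not change after the preprocessing. -/
structure Mem (N : PathNetwork) (k K : ℕ) (σ : Store) : Prop where
  n : σ.nvar wN = N.n
  k : σ.nvar wK = k
  size : σ.nvar wSize = 2 ^ K
  tau : σ.rvar rTau = N.τ
  load : ∀ i, i ≤ N.n → σ.rarr aLoad i = N.load i
  travel : ∀ i, i ≤ N.n → σ.rarr aTravel i = N.travel i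
  keyL : IsMaxTree N.keyL K (σ.rarr aKeyL)
  keyR : IsMaxTree N.keyR K (σ.rarr aKeyR)

lemma Mem.agree {N : PathNetwork} {k K : ℕ} {σ σ' : Store} (h : N.Mem k K σ) (ha : AgreeOut σ σ') :
    N.Mem k K σ' := by
  constructor
  · rw [ha.nvar _ (by omega), h.n]
  · rw [ha.nvar _ (by omega), h.k]
  · rw [ha.nvar _ (by omega), h.size]
  · rw [ha.rvar _ (by omega), h.tau]
  · rw [ha.rarr _ (by norm_num)]; exact h.load
  · rw [ha.rarr _ (by norm_num)]; exact h.travel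
  · rw [ha.rarr _ (by norm_num)]; exact h.keyL
  · rw [ha.rarr _ (by norm_num)]; exact h.keyR

end PathNetwork

/-! ### The search in a tree of maxima -/

namespace RealRAM

/-- The program `cmp` compares the threshold in the variable `rThr` with an unknown number, of which
it is known in the memory `σ` that `Known σ t` holds for it.  The comparison may narrow down
this knowledge. -/
structure Oracle (N : PathNetwork) (k K B : ℕ) (cmp : Prog) (cc : ℕ) (Inv : Store → Prop)
    (Known : Store → ℝ → Prop) : Prop where
  mem : ∀ {σ}, Inv σ → N.Mem k K σ
  agree : ∀ {σ σ'}, Agree σ σ' → Inv σ → Inv σ'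
  known : ∀ {σ σ' t}, Agree σ σ' → (Known σ' t ↔ Known σ t)
  run : ∀ {σ}, Inv σ → Run B cmp σ cc fun σ' => Inv σ' ∧ Keep σ σ' ∧
    (∀ t, Known σ' t → Known σ t) ∧
    ((σ'.nvar wFlag = 1 ∧ ∀ t, Known σ' t → σ.rvar rThr ≤ t) ∨
      (σ'.nvar wFlag = 0 ∧ ∀ t, Known σ' t → t < σ.rvar rThr))

/-- Move the position beyond the block that starts there if the threshold so obtained passes the
comparison. -/
def tryBlock (arr : ℕ) (lim : NExpr) (thr cmp : Prog) : Prog :=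
  .seq (.rset rNew (.get arr (.div (.add (.var wSize) (.var wPos)) (.var wStep)))) <|
  .seq (.ite (.rlt (.var rNew) (.var rMax)) (.rset rNew (.var rMax)) .skip) <|
  .seq (.ite (.nlt (.add (.var wPos) (.var wStep)) lim) (.seq thr cmp)
    (.nset wFlag (.const 0))) <|
  .ite (.nlt (.const 0) (.var wFlag))
    (.seq (.nset wPos (.add (.var wPos) (.var wStep))) (.rset rMax (.var rNew))) .skip

/-- Try larger and larger blocks, each aligned to its length, until a comparison fails. -/
def searchUp (arr : ℕ) (lim : NExpr) (thr cmp : Prog) : Prog :=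
  .loop (.and (.nlt (.const 0) (.var wFlag)) (.nlt (.var wStep) (.var wSize))) <|
  .seq (.ite (.nlt (.mul (.const 2) (.div (.var wPos) (.mul (.const 2) (.var wStep))))
      (.div (.var wPos) (.var wStep))) (tryBlock arr lim thr cmp) .skip) <|
  .ite (.nlt (.const 0) (.var wFlag)) (.nset wStep (.mul (.const 2) (.var wStep))) .skip

/-- Try smaller and smaller blocks. -/
def searchDown (arr : ℕ) (lim : NExpr) (thr cmp : Prog) : Prog :=
  .loop (.nlt (.const 1) (.var wStep)) <|
  .seq (.nset wStep (.div (.var wStep) (.const 2))) (tryBlock arr lim thr cmp)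

/-- Move the position to the last place before `lim` whose threshold passes the comparison. -/
def search (arr : ℕ) (lim : NExpr) (thr cmp : Prog) : Prog :=
  .seq (.nset wStep (.const 1)) <| .seq (.nset wFlag (.const 1)) <|
  .seq (searchUp arr lim thr cmp) (searchDown arr lim thr cmp)

section search

variable {N : PathNetwork} {k K B : ℕ} {cmp : Prog} {cc : ℕ} {Inv : Store → Prop}
  {Known : Store → ℝ → Prop}

/-- The data of a search: `f` is the function of which the maxima are taken, `start` the place where
the search begins, `L` the bound for the places, and `v q` the threshold for the place `q`, which
the program `thr` computes.  The search begins with the memory `σ₀`. -/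
structure SearchData (N : PathNetwork) (K B : ℕ) (Inv : Store → Prop) (arr : ℕ) (lim : NExpr)
    (thr : Prog) (ct : ℕ) (f : ℕ → ℝ) (start L : ℕ) (v : ℕ → ℝ) (σ₀ : Store) : Prop where
  size_le : 2 * 2 ^ K ≤ B
  L_le : L ≤ 2 ^ K
  size : ∀ {σ}, Inv σ → σ.nvar wSize = 2 ^ K
  tree : ∀ {σ}, Inv σ → IsMaxTree f K (σ.rarr arr)
  lim_eval : ∀ {σ}, Inv σ → lim.eval σ = L
  thr_run : ∀ {σ}, Inv σ → Frame σ₀ σ → start ≤ σ.nvar wPos →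
    σ.nvar wPos + σ.nvar wStep < L → 0 < σ.nvar wStep →
    σ.rvar rNew = rangeMax f start (σ.nvar wPos + σ.nvar wStep) →
    Run B thr σ ct fun σ' => σ' = σ.setR rThr (v (σ.nvar wPos + σ.nvar wStep))

/-- The state of a search: it stands at `r * 2 ^ j` and is about to try blocks of length `2 ^ j`. -/
structure SearchState (K : ℕ) (Inv : Store → Prop) (Known : Store → ℝ → Prop)
    (f : ℕ → ℝ) (start L : ℕ) (v : ℕ → ℝ) (σ₀ σ : Store) (j r : ℕ) : Prop where
  inv : Inv σ
  frame : Frame σ₀ σ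
  known : ∀ t, Known σ t → Known σ₀ t
  j_le : j ≤ K
  step : σ.nvar wStep = 2 ^ j
  pos : σ.nvar wPos = r * 2 ^ j
  start_le : start ≤ r * 2 ^ j
  lt : r * 2 ^ j < L
  max : σ.rvar rMax = rangeMax f start (r * 2 ^ j)
  good : r * 2 ^ j = start ∨ ∀ t, Known σ t → v (r * 2 ^ j) ≤ t

/-- The place `q` is known to fail the comparison, or is out of bounds. -/
def IsBad (Known : Store → ℝ → Prop) (L : ℕ) (v : ℕ → ℝ) (σ : Store) (q : ℕ) : Prop :=
  q < L → ∀ t, Known σ t → t < v q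

variable {arr : ℕ} {lim : NExpr} {thr : Prog} {ct : ℕ} {f : ℕ → ℝ} {start L : ℕ} {v : ℕ → ℝ}
  {σ₀ σ : Store} {j r : ℕ}

lemma IsBad.mono {σ' : Store} {q : ℕ} (h : IsBad Known L v σ q)
    (hk : ∀ t, Known σ' t → Known σ t) : IsBad Known L v σ' q :=
  fun hq t ht => h hq t (hk t ht)

lemma SearchState.setStep (hO : Oracle N k K B cmp cc Inv Known) {j' r' : ℕ}
    (h : SearchState K Inv Known f start L v σ₀ σ j r) (hj : j' ≤ K)
    (hr : r * 2 ^ j = r' * 2 ^ j') :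
    SearchState K Inv Known f start L v σ₀ (σ.setN wStep (2 ^ j')) j' r' := by
  have ha : Agree σ (σ.setN wStep (2 ^ j')) := (Agree.refl σ).setN (by omega)
  refine ⟨hO.agree ha h.inv, h.frame.trans ⟨?_, ?_, ?_, rfl⟩,
    fun t ht => h.known t ((hO.known ha).1 ht), hj, ?_, ?_, hr ▸ h.start_le, hr ▸ h.lt,
    hr ▸ h.max, ?_⟩
  · simp
  · simp
  · simp
  · simp
  · rw [← hr]
    simpa using h.pos
  · rw [← hr]
    exact h.good.imp_right fun h t ht => h t ((hO.known ha).1 ht)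

/-- A bound for the cost of one round of a search. -/
def roundCost (lim : NExpr) (ct cc : ℕ) : ℕ := lim.cost + ct + cc + 80

/-- After an attempt, either the position has moved by one block, or the place behind the block is
known to be bad. -/
lemma SearchState.run_tryBlock (hO : Oracle N k K B cmp cc Inv Known)
    (hD : SearchData N K B Inv arr lim thr ct f start L v σ₀)
    (h : SearchState K Inv Known f start L v σ₀ σ j r) :
    Run B (tryBlock arr lim thr cmp) σ (lim.cost + ct + cc + 40) fun σ' =>
      (∀ t, Known σ' t → Known σ t) ∧ ∃ r', SearchState K Inv Known f start L v σ₀ σ' j r' ∧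
      ((σ'.nvar wFlag = 1 ∧ r' = r + 1) ∨
        (σ'.nvar wFlag = 0 ∧ r' = r ∧ IsBad Known L v σ' ((r + 1) * 2 ^ j))) := by
  have hL := hD.L_le
  have hB := hD.size_le
  have hlt := h.lt
  have hpow : 0 < 2 ^ j := by positivity
  have hget := (hD.tree h.inv).get h.j_le (hlt.trans_le hL)
  have hsucc : (r + 1) * 2 ^ j = r * 2 ^ j + 2 ^ j := Nat.succ_mul _ _
  have hmax := max_rangeMax f h.start_le (show r * 2 ^ j < (r + 1) * 2 ^ j by omega)
  -- The memory before the comparison.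
  set σ₁ := σ.setR rNew (rangeMax f start ((r + 1) * 2 ^ j)) with hσ₁
  have ha₁ : Agree σ σ₁ := (Agree.refl σ).setR (by omega)
  have hi₁ : Inv σ₁ := hO.agree ha₁ h.inv
  have hpos₁ : σ₁.nvar wPos = r * 2 ^ j := h.pos
  have hstep₁ : σ₁.nvar wStep = 2 ^ j := h.step
  have hf₁ : Frame σ₀ σ₁ := by
    refine h.frame.trans ⟨rfl, rfl, rfl, ?_⟩
    simp [hσ₁]
  have hstate : ∀ {σ'}, Inv σ' → Keep σ₁ σ' → (∀ t, Known σ' t → Known σ₁ t) →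
      SearchState K Inv Known f start L v σ₀ σ' j r := by
    intro σ' hi hk hkn
    have hkn' : ∀ t, Known σ' t → Known σ t := fun t ht => (hO.known ha₁).1 (hkn t ht)
    refine ⟨hi, hf₁.trans hk.frame, fun t ht => h.known t (hkn' t ht), h.j_le,
      hk.step.trans h.step, hk.pos.trans h.pos, h.start_le, h.lt, ?_, ?_⟩
    · rw [hk.max, ← h.max]
      simp [hσ₁]
    · exact h.good.imp_right fun h t ht => h t (hkn' t ht)
  have hcmp : Run B (.ite (.nlt (.add (.var wPos) (.var wStep)) lim) (.seq thr cmp)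
      (.nset wFlag (.const 0))) σ₁ (lim.cost + ct + cc + 12) fun σ' =>
      Inv σ' ∧ Keep σ₁ σ' ∧ (∀ t, Known σ' t → Known σ₁ t) ∧
      ((σ'.nvar wFlag = 1 ∧ (r + 1) * 2 ^ j < L ∧ ∀ t, Known σ' t → v ((r + 1) * 2 ^ j) ≤ t) ∨
        (σ'.nvar wFlag = 0 ∧ IsBad Known L v σ' ((r + 1) * 2 ^ j))) := by
    refine (Run.ite (c₁ := ct + cc) (c₂ := 2) (fun hb => ?_) (fun hb => ?_)).mono ?_
      (fun _ h => h)
    · have hb' : (r + 1) * 2 ^ j < L := by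
        simp only [BExpr.holds, NExpr.eval, hD.lim_eval hi₁, hpos₁, hstep₁] at hb
        omega
      have hq : σ₁.nvar wPos + σ₁.nvar wStep = (r + 1) * 2 ^ j := by rw [hpos₁, hstep₁, hsucc]
      refine Run.seq ((hD.thr_run hi₁ hf₁ ?_ ?_ ?_ ?_).mono le_rfl ?_)
      · rw [hpos₁]; exact h.start_le
      · rwa [hq]
      · rwa [hstep₁]
      · rw [hq]; simp [hσ₁]
      · rintro _ rfl
        have ha₂ : Agree σ₁ (σ₁.setR rThr (v (σ₁.nvar wPos + σ₁.nvar wStep))) :=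
          (Agree.refl _).setR (by omega)
        refine (hO.run (hO.agree ha₂ hi₁)).mono le_rfl ?_
        rintro σ' ⟨hi, hk, hkn, hr⟩
        refine ⟨hi, ⟨?_, ?_, ?_, ?_, ?_, ?_, ?_, ?_⟩, fun t ht => (hO.known ha₂).1 (hkn t ht), ?_⟩
        · exact hk.pos
        · exact hk.step
        · exact hk.start
        · exact hk.count
        · exact hk.sink
        · simpa using hk.max
        · simpa using hk.new
        · simpa using hk.left
        · rw [hq] at hr
          simp only [Store.setR_rvar, if_true] at hr
          exact hr.imp (fun h => ⟨h.1, hb', h.2⟩) (fun h => ⟨h.1, fun _ => h.2⟩)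
    · have hb' : ¬ (r + 1) * 2 ^ j < L := by
        simp only [BExpr.holds, NExpr.eval, hD.lim_eval hi₁, hpos₁, hstep₁] at hb
        omega
      have ha₂ : Agree σ₁ (σ₁.setN wFlag 0) := (Agree.refl _).setN (by omega)
      refine Run.nset (Nat.zero_le _) ⟨hO.agree ha₂ hi₁, ?_, fun t ht => (hO.known ha₂).1 ht, ?_⟩
      · constructor <;> simp [NExpr.eval]
      · exact .inr ⟨by simp [NExpr.eval], fun h => absurd h hb'⟩
    · simp only [BExpr.cost, NExpr.cost]
      omega
  have hend : ∀ σ', (Inv σ' ∧ Keep σ₁ σ' ∧ (∀ t, Known σ' t → Known σ₁ t) ∧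
      ((σ'.nvar wFlag = 1 ∧ (r + 1) * 2 ^ j < L ∧ ∀ t, Known σ' t → v ((r + 1) * 2 ^ j) ≤ t) ∨
        (σ'.nvar wFlag = 0 ∧ IsBad Known L v σ' ((r + 1) * 2 ^ j)))) →
      Run B (.ite (.nlt (.const 0) (.var wFlag))
        (.seq (.nset wPos (.add (.var wPos) (.var wStep))) (.rset rMax (.var rNew))) .skip)
        σ' 11 fun σ' => (∀ t, Known σ' t → Known σ t) ∧
          ∃ r', SearchState K Inv Known f start L v σ₀ σ' j r' ∧
          ((σ'.nvar wFlag = 1 ∧ r' = r + 1) ∨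
            (σ'.nvar wFlag = 0 ∧ r' = r ∧ IsBad Known L v σ' ((r + 1) * 2 ^ j))) := by
    rintro σ' ⟨hi, hk, hkn, hr⟩
    have hst := hstate hi hk hkn
    have hkn' : ∀ t, Known σ' t → Known σ t := fun t ht => (hO.known ha₁).1 (hkn t ht)
    refine Run.ite (c₁ := 6) (c₂ := 1) (fun hb => ?_) (fun hb => ?_)
    · rcases hr with ⟨hfl, hq, hv⟩ | ⟨hfl, -⟩
      · refine Run.seq (Run.nset ?_ (Run.rset ?_))
        · simp only [NExpr.eval, hst.pos, hst.step]
          omega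
        · simp only [NExpr.eval, RExpr.eval, hst.pos, hst.step, ← hsucc]
          have ha : Agree σ' ((σ'.setN wPos ((r + 1) * 2 ^ j)).setR rMax
              ((σ'.setN wPos ((r + 1) * 2 ^ j)).rvar rNew)) :=
            ((Agree.refl _).setN (by omega)).setR (by omega)
          refine ⟨fun t ht => hkn' t ((hO.known ha).1 ht), r + 1, ?_,
            .inl ⟨by simpa using hfl, rfl⟩⟩
          refine ⟨hO.agree ha hi, hst.frame.trans ⟨?_, ?_, ?_, ?_⟩,
            fun t ht => hst.known t ((hO.known ha).1 ht), h.j_le, ?_, ?_, ?_, hq, ?_, ?_⟩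
          · simp
          · simp
          · simp
          · simp
          · simpa using hst.step
          · simp
          · have := h.start_le
            omega
          · simp [hk.new, hσ₁]
          · exact .inr fun t ht => hv t ((hO.known ha).1 ht)
      · simp [BExpr.holds, NExpr.eval, hfl] at hb
    · rcases hr with ⟨hfl, -⟩ | ⟨hfl, hbad⟩
      · simp [BExpr.holds, NExpr.eval, hfl] at hb
      · exact Run.skip ⟨hkn', r, hst, .inr ⟨hfl, rfl, hbad⟩⟩
  -- The maximum over the vertices up to the end of the block.
  have hprep : Run B (.ite (.rlt (.var rNew) (.var rMax)) (.rset rNew (.var rMax)) .skip)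
      (σ.setR rNew (rangeMax f (r * 2 ^ j) ((r + 1) * 2 ^ j))) 7 fun σ' => σ' = σ₁ := by
    refine (Run.ite (c₁ := 2) (c₂ := 1) (fun hb => Run.rset ?_) (fun hb => Run.skip ?_)).mono ?_
      (fun _ h => h)
    · simp only [BExpr.holds, RExpr.eval, Store.setR_rvar, if_true, h.max] at hb ⊢
      norm_num [h.max] at hb ⊢
      rw [Store.setR_setR, hσ₁, ← hmax, max_eq_left hb.le]
    · simp only [BExpr.holds, RExpr.eval, Store.setR_rvar, if_true, h.max] at hb
      norm_num [h.max] at hb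
      rw [hσ₁, ← hmax, max_eq_right hb]
    · simp [BExpr.cost, RExpr.cost]
  have hget' : (RExpr.get arr (.div (.add (.var wSize) (.var wPos)) (.var wStep))).eval σ =
      rangeMax f (r * 2 ^ j) ((r + 1) * 2 ^ j) := by
    simp only [RExpr.eval, NExpr.eval, hD.size h.inv, h.pos, h.step, hget]
  refine (Run.seq (c₂ := 7 + (lim.cost + ct + cc + 12 + 11)) (Run.rset ?_)).mono ?_ (fun _ h => h)
  · rw [hget']
    refine Run.seq (hprep.mono le_rfl ?_)
    rintro _ rfl
    exact Run.seq (hcmp.mono le_rfl hend)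
  · simp only [RExpr.cost, NExpr.cost]
    omega

/-- The place looked for lies in the block at which the first phase ends.  Blocks of length `2 ^ j`
start at multiples of `2 ^ j`, so that each is a node of the tree. -/
lemma run_searchUp (hO : Oracle N k K B cmp cc Inv Known)
    (hD : SearchData N K B Inv arr lim thr ct f start L v σ₀)
    (h : SearchState K Inv Known f start L v σ₀ σ 0 start) (hfl : σ.nvar wFlag = 1) :
    Run B (searchUp arr lim thr cmp) σ (K * roundCost lim ct cc + 8) fun σ' =>
      ∃ j r, SearchState K Inv Known f start L v σ₀ σ' j r ∧
        IsBad Known L v σ' ((r + 1) * 2 ^ j) := by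
  refine (Run.loop (cb := lim.cost + ct + cc + 62) (fun e σ =>
    (σ.nvar wFlag = 1 ∧ ∃ j r, SearchState K Inv Known f start L v σ₀ σ j r ∧ K ≤ j + e) ∨
    (σ.nvar wFlag = 0 ∧ ∃ j r, SearchState K Inv Known f start L v σ₀ σ j r ∧
        IsBad Known L v σ ((r + 1) * 2 ^ j))) ?_ ?_ K σ
    (.inl ⟨hfl, 0, start, h, by omega⟩)).mono ?_ (fun _ h => h)
  · rintro e σ hI ⟨hb1, hb2⟩
    simp only [BExpr.holds, NExpr.eval] at hb1 hb2
    rcases hI with ⟨hfl, j, r, hS, hj⟩ | ⟨hfl, -⟩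
    swap
    · omega
    rw [hS.step, hD.size hS.inv] at hb2
    have hjK : j < K := (Nat.pow_lt_pow_iff_right (by norm_num)).1 hb2
    refine ⟨e - 1, by omega, ?_⟩
    have hpow : 0 < 2 ^ j := by positivity
    have hBj : 2 * 2 ^ j ≤ B := by
      have := hD.size_le
      omega
    -- The position becomes a multiple of the double step, unless the comparison fails.
    refine (Run.seq (c₁ := lim.cost + ct + cc + 53) (c₂ := 9) (Run.mono (R := fun σ' =>
      (σ'.nvar wFlag = 1 ∧ ∃ r', SearchState K Inv Known f start L v σ₀ σ' j (2 * r')) ∨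
      (σ'.nvar wFlag = 0 ∧ ∃ r, SearchState K Inv Known f start L v σ₀ σ' j r ∧
        IsBad Known L v σ' ((r + 1) * 2 ^ j))) (Run.ite (c₁ := lim.cost + ct + cc + 40) (c₂ := 1)
        (fun hb => ?_) (fun hb => Run.skip ?_)) ?_ ?_)).mono (by omega) (fun _ h => h)
    · have hodd : r = 2 * (r / 2) + 1 := by
        simp only [BExpr.holds, NExpr.eval, hS.pos, hS.step] at hb
        rw [mul_comm 2 (2 ^ j), ← Nat.div_div_eq_div_mul, Nat.mul_div_cancel _ hpow] at hb
        omega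
      refine (hS.run_tryBlock hO hD).mono le_rfl ?_
      rintro σ' ⟨-, r', hS', ⟨hfl', rfl⟩ | ⟨hfl', rfl, hbad⟩⟩
      · exact .inl ⟨hfl', r / 2 + 1, by rwa [show 2 * (r / 2 + 1) = r + 1 by omega]⟩
      · exact .inr ⟨hfl', _, hS', hbad⟩
    · have heven : r = 2 * (r / 2) := by
        simp only [BExpr.holds, NExpr.eval, hS.pos, hS.step] at hb
        rw [mul_comm 2 (2 ^ j), ← Nat.div_div_eq_div_mul, Nat.mul_div_cancel _ hpow] at hb
        omega
      exact .inl ⟨hfl, r / 2, by rwa [← heven]⟩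
    · simp only [BExpr.cost, NExpr.cost]
      omega
    · intro σ' hI'
      refine (Run.ite (c₁ := 4) (c₂ := 1) (fun hb => ?_) (fun hb => Run.skip ?_)).mono
        (by simp [BExpr.cost, NExpr.cost]) (fun _ h => h)
      · rcases hI' with ⟨hfl', r', hS'⟩ | ⟨hfl', -⟩
        · have he : (NExpr.mul (.const 2) (.var wStep)).eval σ' = 2 ^ (j + 1) := by
            simp only [NExpr.eval, hS'.step, pow_succ]
            ring
          have hle : (NExpr.mul (.const 2) (.var wStep)).eval σ' ≤ B := by
            rw [he, pow_succ]
            omega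
          refine Run.nset hle (.inl ⟨by simpa using hfl', j + 1, r', ?_, by omega⟩)
          rw [he]
          exact hS'.setStep hO hjK (by ring)
        · simp [BExpr.holds, NExpr.eval, hfl'] at hb
      · rcases hI' with ⟨hfl', -⟩ | ⟨hfl', r', hS', hbad⟩
        · simp [BExpr.holds, NExpr.eval, hfl'] at hb
        · exact .inr ⟨hfl', j, r', hS', hbad⟩
  · rintro e σ hI hb
    rcases hI with ⟨hfl, j, r, hS, -⟩ | ⟨-, h⟩
    · have hL := hD.L_le
      have hlt := hS.lt
      have hjK : j = K := by
        refine le_antisymm hS.j_le ?_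
        simp only [BExpr.holds, NExpr.eval, hfl, hS.step, hD.size hS.inv, zero_lt_one, true_and,
          not_lt] at hb
        exact (Nat.pow_le_pow_iff_right (by norm_num)).1 hb
      subst hjK
      have hr : r = 0 := by
        by_contra hr
        have := Nat.le_mul_of_pos_left (2 ^ j) (Nat.pos_of_ne_zero hr)
        omega
      exact ⟨j, r, hS, fun hq => by rw [hr] at hq; omega⟩
    · exact h
  · simp only [BExpr.cost, NExpr.cost, roundCost]
    have : K * (lim.cost + ct + cc + 62 + (1 + 1 + 1 + (1 + 1 + 1) + 1) + 1) ≤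
      K * (lim.cost + ct + cc + 80) := Nat.mul_le_mul_left _ (by omega)
    omega

/-- The second phase is a binary search in the block found by the first. -/
lemma run_searchDown (hO : Oracle N k K B cmp cc Inv Known)
    (hD : SearchData N K B Inv arr lim thr ct f start L v σ₀)
    (h : SearchState K Inv Known f start L v σ₀ σ j r)
    (hbad : IsBad Known L v σ ((r + 1) * 2 ^ j)) :
    Run B (searchDown arr lim thr cmp) σ (K * roundCost lim ct cc + 4) fun σ' =>
      ∃ r, SearchState K Inv Known f start L v σ₀ σ' 0 r ∧ IsBad Known L v σ' (r + 1) := by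
  refine (Run.loop (cb := lim.cost + ct + cc + 44) (fun e σ =>
    ∃ j r, j ≤ e ∧ SearchState K Inv Known f start L v σ₀ σ j r ∧
        IsBad Known L v σ ((r + 1) * 2 ^ j)) ?_ ?_ K σ
    ⟨j, r, h.j_le, h, hbad⟩).mono ?_ (fun _ h => h)
  · rintro e σ ⟨j, r, hj, hS, hbad⟩ hb
    simp only [BExpr.holds, NExpr.eval, hS.step] at hb
    obtain ⟨j, rfl⟩ : ∃ j', j = j' + 1 :=
      Nat.exists_eq_succ_of_ne_zero (fun h => by simp [h] at hb)
    refine ⟨e - 1, by omega, ?_⟩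
    have he : (NExpr.div (.var wStep) (.const 2)).eval σ = 2 ^ j := by
      simp only [NExpr.eval, hS.step, pow_succ]
      omega
    have hjK := hS.j_le
    have hle : (NExpr.div (.var wStep) (.const 2)).eval σ ≤ B := by
      have h1 := hD.size_le
      have h2 : 2 ^ j ≤ 2 ^ K := Nat.pow_le_pow_right (by norm_num) (by omega)
      omega
    refine (Run.seq (c₂ := lim.cost + ct + cc + 40) (Run.nset hle ?_)).mono ?_ (fun _ h => h)
    · rw [he]
      have hS' := hS.setStep hO (j' := j) (r' := 2 * r) (by omega) (by ring)
      have hk : ∀ t, Known (σ.setN wStep (2 ^ j)) t → Known σ t := fun t ht =>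
        (hO.known ((Agree.refl σ).setN (by omega))).1 ht
      refine (hS'.run_tryBlock hO hD).mono le_rfl ?_
      rintro σ' ⟨hk', r', hS'', ⟨-, rfl⟩ | ⟨-, rfl, hbad'⟩⟩
      · refine ⟨j, _, by omega, hS'', ?_⟩
        rw [show (2 * r + 1 + 1) * 2 ^ j = (r + 1) * 2 ^ (j + 1) by ring]
        exact hbad.mono fun t ht => hk t (hk' t ht)
      · exact ⟨j, _, by omega, hS'', hbad'⟩
    · simp only [NExpr.cost]
      omega
  · rintro e σ ⟨j, r, -, hS, hbad⟩ hb
    simp only [BExpr.holds, NExpr.eval, hS.step, not_lt] at hb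
    obtain rfl : j = 0 := by
      by_contra hj
      have := Nat.one_lt_two_pow hj
      omega
    exact ⟨r, hS, by simpa using hbad⟩
  · simp only [BExpr.cost, NExpr.cost, roundCost]
    have : K * (lim.cost + ct + cc + 44 + (1 + 1 + 1) + 1) ≤
      K * (lim.cost + ct + cc + 80) := Nat.mul_le_mul_left _ (by omega)
    omega

/-- A search finds, in logarithmically many rounds, a place whose threshold passes the comparison
while that of the next place does not. -/
theorem run_search (hO : Oracle N k K B cmp cc Inv Known)
    (hD : SearchData N K B Inv arr lim thr ct f start L v σ₀) (hI : Inv σ₀)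
    (hpos : σ₀.nvar wPos = start) (hstart : start < L) (hmax : σ₀.rvar rMax = f start) :
    Run B (search arr lim thr cmp) σ₀ (2 * (K * roundCost lim ct cc) + 16) fun σ' =>
      Inv σ' ∧ Frame σ₀ σ' ∧ (∀ t, Known σ' t → Known σ₀ t) ∧ ∃ p, σ'.nvar wPos = p ∧
        start ≤ p ∧ p < L ∧ σ'.rvar rMax = rangeMax f start p ∧
        (p = start ∨ ∀ t, Known σ' t → v p ≤ t) ∧ IsBad Known L v σ' (p + 1) := by
  have hB : 1 ≤ B := by
    have := hD.size_le
    have : 0 < 2 ^ K := by positivity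
    omega
  refine (Run.seq (Run.nset hB (Run.seq (Run.nset hB (Run.seq (Run.mono (run_searchUp hO hD ?_ ?_)
    le_rfl ?_)))))).mono (c₁ := 2 + (2 + (K * roundCost lim ct cc + 8 +
      (K * roundCost lim ct cc + 4)))) (by omega) (fun _ h => h)
  · have ha : Agree σ₀ ((σ₀.setN wStep 1).setN wFlag 1) :=
      ((Agree.refl _).setN (by omega)).setN (by omega)
    refine ⟨hO.agree ha hI, ⟨?_, ?_, ?_, ?_⟩, fun t ht => (hO.known ha).1 ht, Nat.zero_le _,
      ?_, ?_, by simp, by simpa using hstart, ?_, by simp⟩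
    · simp
    · simp
    · simp
    · simp
    · simp [NExpr.eval]
    · simpa using hpos
    · simpa [rangeMax_self] using hmax
  · simp [NExpr.eval]
  · rintro σ ⟨j, r, hS, hbad⟩
    refine (run_searchDown hO hD hS hbad).mono le_rfl ?_
    rintro σ' ⟨p, hS', hbad'⟩
    have hp : p * 2 ^ 0 = p := by simp
    have h1 := hS'.pos
    have h2 := hS'.start_le
    have h3 := hS'.lt
    have h4 := hS'.max
    have h5 := hS'.good
    rw [hp] at h1 h2 h3 h4 h5
    exact ⟨hS'.inv, hS'.frame, hS'.known, p, h1, h2, h3, h4, h5, hbad'⟩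

end search

end RealRAM

/-! ### One step of the greedy placement -/

namespace RealRAM

/-- The time that the evacuees of the vertices from the start to the end of the block need for
reaching the place behind the block. -/
def thrLeft : Prog :=
  .rset rThr (.sub (.add (.var rNew) (.get aTravel (.add (.var wPos) (.var wStep))))
    (.get aLoad (.var wStart)))

/-- The time for which the greedy placement serves the vertices up to the end of the block. -/
def thrRight : Prog :=
  .seq (.rset rThr (.sub (.add (.var rNew) (.get aLoad (.add (.var wPos) (.var wStep))))
    (.get aTravel (.var wSink)))) <|
  .ite (.rlt (.div (.sub (.add (.add (.var rNew) (.get aLoad (.add (.var wPos) (.var wStep))))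
      (.var rLeft)) (.get aLoad (.var wStart))) (.const 2)) (.var rThr))
    (.rset rThr (.div (.sub (.add (.add (.var rNew) (.get aLoad (.add (.var wPos) (.var wStep))))
      (.var rLeft)) (.get aLoad (.var wStart))) (.const 2))) .skip

/-- From the first vertex to serve, find the place of the next sink and the first vertex it does not
serve. -/
def greedyStep (cmp : Prog) : Prog :=
  .seq (.nset wPos (.var wStart)) <|
  .seq (.rset rMax (.get aKeyL (.add (.var wSize) (.var wPos)))) <|
  .seq (search aKeyL (.var wN) thrLeft cmp) <|
  .seq (.nset wSink (.var wPos)) <|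
  .seq (.rset rLeft (.get aKeyL (.add (.var wSize) (.var wPos)))) <|
  .seq (.ite (.rlt (.var rLeft) (.var rMax)) (.rset rLeft (.var rMax)) .skip) <|
  .seq (.nset wPos (.add (.var wPos) (.const 1))) <|
  .seq (.rset rMax (.get aKeyR (.add (.var wSize) (.var wPos)))) <|
  search aKeyR (.add (.var wN) (.const 1)) thrRight cmp

/-- A bound for the cost of a greedy step. -/
def stepCost (K cc : ℕ) : ℕ := 4 * (K * (cc + 130)) + 100

section
variable {N : PathNetwork} {k K B : ℕ} {cmp : Prog} {cc : ℕ} {Inv : Store → Prop}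
  {Known : Store → ℝ → Prop} {σ : Store} {a : ℕ}

lemma searchData_left (hO : Oracle N k K B cmp cc Inv Known) (hB : 2 * 2 ^ K ≤ B)
    (hK : N.n < 2 ^ K) (ha : σ.nvar wStart = a) (han : a < N.n) :
    SearchData N K B Inv aKeyL (.var wN) thrLeft 10 N.keyL a N.n (N.leftTime a) σ where
  size_le := hB
  L_le := hK.le
  size h := (hO.mem h).size
  tree h := (hO.mem h).keyL
  lim_eval h := (hO.mem h).n
  thr_run := by
    intro σ' hi hf _ hlt _ hnew
    have hm := hO.mem hi
    refine Run.rset ?_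
    congr 1
    simp only [RExpr.eval, NExpr.eval, hf.start, ha, hnew]
    rw [hm.travel _ (by omega), hm.load _ (by omega), PathNetwork.leftTime]

lemma searchData_right (hO : Oracle N k K B cmp cc Inv Known) (hB : 2 * 2 ^ K ≤ B)
    (hK : N.n < 2 ^ K) (ha : σ.nvar wStart = a) (han : a < N.n) {h : ℕ} (hh : σ.nvar wSink = h)
    (hhn : h < N.n) (hl : σ.rvar rLeft = rangeMax N.keyL a (h + 1)) :
    SearchData N K B Inv aKeyR (.add (.var wN) (.const 1)) thrRight 41 N.keyR (h + 1) (N.n + 1)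
      (N.rightTime a h) σ where
  size_le := hB
  L_le := hK
  size h := (hO.mem h).size
  tree h := (hO.mem h).keyR
  lim_eval h := by simp only [NExpr.eval, (hO.mem h).n]
  thr_run := by
    intro σ' hi hf _ hlt _ hnew
    have hm := hO.mem hi
    have e1 : (RExpr.sub (.add (.var rNew) (.get aLoad (.add (.var wPos) (.var wStep))))
        (.get aTravel (.var wSink))).eval σ' =
        rangeMax N.keyR (h + 1) (σ'.nvar wPos + σ'.nvar wStep) +
          N.load (σ'.nvar wPos + σ'.nvar wStep) - N.travel h := by
      simp only [RExpr.eval, NExpr.eval, hf.sink, hh, hnew]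
      rw [hm.travel _ (by omega), hm.load _ (by omega)]
    have e2 : ∀ u, (RExpr.div (.sub (.add (.add (.var rNew) (.get aLoad
        (.add (.var wPos) (.var wStep)))) (.var rLeft)) (.get aLoad (.var wStart)))
        (.const 2)).eval (σ'.setR rThr u) =
        (rangeMax N.keyR (h + 1) (σ'.nvar wPos + σ'.nvar wStep) +
          N.load (σ'.nvar wPos + σ'.nvar wStep) + rangeMax N.keyL a (h + 1) - N.load a) / 2 := by
      intro u
      have hl' : σ'.rvar rLeft = rangeMax N.keyL a (h + 1) := hf.left.trans hl
      have hs' : σ'.nvar wStart = a := hf.start.trans ha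
      simp [RExpr.eval, NExpr.eval, hs', hnew, hl', hm.load _ (show
        σ'.nvar wPos + σ'.nvar wStep ≤ N.n by omega), hm.load _ han.le]
    refine (Run.seq (Run.rset (Run.ite (c₁ := 14) (c₂ := 1) (fun hb => Run.rset ?_)
      (fun hb => Run.skip ?_)))).mono ?_ (fun _ h => h)
    · simp only [BExpr.holds, e1, e2] at hb ⊢
      rw [Store.setR_setR, PathNetwork.rightTime, min_eq_right]
      simpa [RExpr.eval] using hb.le
    · simp only [BExpr.holds, e1, e2] at hb ⊢
      rw [PathNetwork.rightTime, min_eq_left]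
      simpa [RExpr.eval] using hb
    · simp [BExpr.cost, RExpr.cost, NExpr.cost]

/-- The place of the sink and the first vertex not served are those of a greedy step for each time
that agrees with the outcomes of the comparisons. -/
theorem run_greedyStep (hO : Oracle N k K B cmp cc Inv Known) (hB : 2 * 2 ^ K ≤ B)
    (hK : N.n < 2 ^ K) (hI : Inv σ) (ha : σ.nvar wStart = a) (han : a < N.n) :
    Run B (greedyStep cmp) σ (stepCost K cc) fun σ' =>
      Inv σ' ∧ σ'.nvar wStart = a ∧ σ'.nvar wCount = σ.nvar wCount ∧
      (∀ t, Known σ' t → Known σ t) ∧ ∃ h b, σ'.nvar wSink = h ∧ σ'.nvar wPos = b ∧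
      σ'.rvar rLeft = rangeMax N.keyL a (h + 1) ∧ ∀ t, Known σ' t → N.GreedyStep t a h b := by
  have hle : ∀ {x}, x ≤ N.n → x ≤ B := fun hx => by omega
  -- The second half, with the place of the sink known.
  have second : ∀ σ₁, Inv σ₁ → σ₁.nvar wStart = a → ∀ h, a ≤ h → h < N.n → σ₁.nvar wPos = h →
      σ₁.rvar rMax = rangeMax N.keyL a h → (h = a ∨ ∀ t, Known σ₁ t → N.leftTime a h ≤ t) →
      (h + 1 < N.n → ∀ t, Known σ₁ t → t < N.leftTime a (h + 1)) →
      Run B (.seq (.nset wSink (.var wPos)) <|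
        .seq (.rset rLeft (.get aKeyL (.add (.var wSize) (.var wPos)))) <|
        .seq (.ite (.rlt (.var rLeft) (.var rMax)) (.rset rLeft (.var rMax)) .skip) <|
        .seq (.nset wPos (.add (.var wPos) (.const 1))) <|
        .seq (.rset rMax (.get aKeyR (.add (.var wSize) (.var wPos)))) <|
        search aKeyR (.add (.var wN) (.const 1)) thrRight cmp) σ₁
        (2 + (5 + (7 + (4 + (5 + (2 * (K * roundCost (.add (.var wN) (.const 1)) 41 cc) + 16))))))
        fun σ' => Inv σ' ∧ σ'.nvar wStart = a ∧ σ'.nvar wCount = σ₁.nvar wCount ∧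
          (∀ t, Known σ' t → Known σ₁ t) ∧ ∃ h b, σ'.nvar wSink = h ∧ σ'.nvar wPos = b ∧
          σ'.rvar rLeft = rangeMax N.keyL a (h + 1) ∧
          ∀ t, Known σ' t → N.GreedyStep t a h b := by
    intro σ₁ hI₁ ha₁ h hah hhn hpos hmax hgood hbad
    have hm := hO.mem hI₁
    have hleaf : σ₁.rarr aKeyL (2 ^ K + h) = N.keyL h := hm.keyL.leaf (by omega)
    have hleafR : σ₁.rarr aKeyR (2 ^ K + (h + 1)) = N.keyR (h + 1) := hm.keyR.leaf (by omega)
    have hmaxL := max_rangeMax N.keyL hah (Nat.lt_succ_self h)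
    rw [Nat.succ_eq_add_one, rangeMax_succ] at hmaxL
    let σ₂ := (σ₁.setN wSink h).setR rLeft (rangeMax N.keyL a (h + 1))
    have hlast : Run B (.seq (.nset wPos (.add (.var wPos) (.const 1))) <|
        .seq (.rset rMax (.get aKeyR (.add (.var wSize) (.var wPos)))) <|
        search aKeyR (.add (.var wN) (.const 1)) thrRight cmp) σ₂
        (4 + (5 + (2 * (K * roundCost (.add (.var wN) (.const 1)) 41 cc) + 16)))
        fun σ' => Inv σ' ∧ σ'.nvar wStart = a ∧ σ'.nvar wCount = σ₁.nvar wCount ∧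
          (∀ t, Known σ' t → Known σ₁ t) ∧ ∃ h b, σ'.nvar wSink = h ∧ σ'.nvar wPos = b ∧
          σ'.rvar rLeft = rangeMax N.keyL a (h + 1) ∧
          ∀ t, Known σ' t → N.GreedyStep t a h b := by
      refine Run.seq (Run.nset ?_ (Run.seq (Run.rset ?_)))
      · simp only [NExpr.eval, σ₂]
        norm_num [hpos]
        omega
      · have e1 : (NExpr.add (.var wPos) (.const 1)).eval σ₂ = h + 1 := by
          simp [NExpr.eval, σ₂, hpos]
        have e2 : (RExpr.get aKeyR (.add (.var wSize) (.var wPos))).eval (σ₂.setN wPos (h + 1)) =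
            N.keyR (h + 1) := by
          simp [RExpr.eval, NExpr.eval, σ₂, hm.size, hleafR]
        rw [e1, e2]
        set σ₃ := (σ₂.setN wPos (h + 1)).setR rMax (N.keyR (h + 1)) with hσ₃
        have ha₃ : Agree σ₁ σ₃ := ((((Agree.refl _).setN (by omega)).setR (by omega)).setN
          (by omega)).setR (by omega)
        refine (run_search hO (searchData_right (σ := σ₃) (h := h) hO hB hK ?_ han ?_ hhn ?_)
          (hO.agree ha₃ hI₁) ?_ (by omega) ?_).mono le_rfl ?_
        · simpa [hσ₃, σ₂] using ha₁
        · simp [hσ₃, σ₂]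
        · simp [hσ₃, σ₂]
        · simp [hσ₃, σ₂]
        · simp [hσ₃, σ₂]
        · rintro σ' ⟨hI', hf, hk, b, hb, hb1, hb2, -, hbg, hbb⟩
          have hk' : ∀ t, Known σ' t → Known σ₁ t := fun t ht => (hO.known ha₃).1 (hk t ht)
          refine ⟨hI', ?_, ?_, hk', h, b, ?_, hb, ?_,
            fun t ht => ⟨hah, hb1, by omega, ?_, ?_, ?_, ?_⟩⟩
          · rw [hf.start]; simpa [hσ₃, σ₂] using ha₁
          · rw [hf.count]; simp [hσ₃, σ₂]
          · rw [hf.sink]; simp [hσ₃, σ₂]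
          · rw [hf.left]; simp [hσ₃, σ₂]
          · exact hgood.imp_right fun hg => hg t (hk' t ht)
          · exact fun hn => hbad hn t (hk' t ht)
          · exact hbg.imp_right fun hg => hg t ht
          · exact fun hn => hbb (by omega) t ht
    refine Run.seq (Run.nset ?_ (Run.seq (Run.rset (Run.seq (Run.mono (c₁ := 7)
      (R := fun σ' => σ' = σ₂) ?_ le_rfl ?_)))))
    · simp only [NExpr.eval, hpos]
      omega
    · have e1 : (NExpr.var wPos).eval σ₁ = h := hpos
      have e2 : (RExpr.get aKeyL (.add (.var wSize) (.var wPos))).eval (σ₁.setN wSink h) =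
          N.keyL h := by
        simp [RExpr.eval, NExpr.eval, hm.size, hpos, hleaf]
      rw [e1, e2]
      refine (Run.ite (c₁ := 2) (c₂ := 1) (fun hb => Run.rset ?_) (fun hb => Run.skip ?_)).mono
        (by simp [BExpr.cost, RExpr.cost]) (fun _ h => h)
      · simp [BExpr.holds, RExpr.eval, hmax] at hb ⊢
        rw [Store.setR_setR, ← max_eq_left hb.le, hmaxL]
      · simp [BExpr.holds, RExpr.eval, hmax] at hb
        rw [← max_eq_right hb, hmaxL]
    · rintro _ rfl
      exact hlast
  have hm := hO.mem hI
  have e1 : (NExpr.var wStart).eval σ = a := ha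
  have e2 : (RExpr.get aKeyL (.add (.var wSize) (.var wPos))).eval (σ.setN wPos a) = N.keyL a := by
    have : σ.rarr aKeyL (2 ^ K + a) = N.keyL a := hm.keyL.leaf (by omega)
    simp [RExpr.eval, NExpr.eval, hm.size, this]
  refine (Run.seq (c₁ := 2) (Run.nset ?_ (Run.seq (c₁ := 5) (Run.rset ?_)))).mono
    (c₁ := 2 + (5 + ((2 * (K * roundCost (.var wN) 10 cc) + 16) + (2 + (5 + (7 + (4 + (5 +
      (2 * (K * roundCost (.add (.var wN) (.const 1)) 41 cc) + 16))))))))) ?_ (fun _ h => h)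
  · rw [e1]; omega
  · rw [e1, e2]
    set σ₃ := (σ.setN wPos a).setR rMax (N.keyL a) with hσ₃
    have ha₃ : Agree σ σ₃ := ((Agree.refl _).setN (by omega)).setR (by omega)
    refine Run.seq ((run_search hO (searchData_left (σ := σ₃) hO hB hK ?_ han)
      (hO.agree ha₃ hI) ?_ han ?_).mono le_rfl ?_)
    · simpa [hσ₃] using ha
    · simp [hσ₃]
    · simp [hσ₃]
    · rintro σ₁ ⟨hI₁, hf, hk, h, hh, hh1, hh2, hmax, hg, hbad⟩
      refine (second σ₁ hI₁ ?_ h hh1 hh2 hh hmax hg hbad).mono le_rfl ?_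
      · rw [hf.start]; simpa [hσ₃] using ha
      · rintro σ' ⟨h1, h2, h3, h4, h5⟩
        refine ⟨h1, h2, ?_, fun t ht => (hO.known ha₃).1 (hk t (h4 t ht)), h5⟩
        rw [h3, hf.count]; simp [hσ₃]
  · have h1 : K * roundCost (.var wN) 10 cc ≤ K * (cc + 130) :=
      Nat.mul_le_mul_left _ (by simp only [roundCost, NExpr.cost]; omega)
    have h2 : K * roundCost (.add (.var wN) (.const 1)) 41 cc ≤ K * (cc + 130) :=
      Nat.mul_le_mul_left _ (by simp only [roundCost, NExpr.cost]; omega)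
    simp only [stepCost]
    omega

end

end RealRAM

/-! ### The test of feasibility -/

namespace RealRAM

/-- Compare the threshold with the given time. -/
def cmpTime : Prog :=
  .ite (.rlt (.var rTime) (.var rThr)) (.nset wFlag (.const 0)) (.nset wFlag (.const 1))

/-- Write down the sink found by a greedy step. -/
def writeSink : Prog :=
  .seq (.nput 0 (.var wCount) (.var wSink)) <|
  .ite (.nlt (.add (.var wSink) (.const 1)) (.var wPos))
    (.seq (.rset rThr (.div (.sub (.sub (.add (.var rTime) (.get aLoad (.var wStart)))
      (.var rLeft)) (.get aTravel (.var wSink))) (.var rTau))) <|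
    .seq (.ite (.rlt (.var rThr) (.const 0)) (.rset rThr (.const 0)) .skip) <|
    .rput 3 (.var wCount) (.var rThr))
    (.rput 3 (.var wCount) (.const 0))

/-- Place the sinks greedily for the given time. -/
def placeSinks : Prog :=
  .seq (.nset wStart (.const 0)) <| .seq (.nset wCount (.const 0)) <|
  .loop (.nlt (.var wCount) (.var wK)) <|
  .seq (.ite (.nlt (.var wStart) (.var wN))
    (.seq (greedyStep cmpTime) (.seq writeSink (.nset wStart (.var wPos))))
    (.seq (.nput 0 (.var wCount) (.const 0)) (.rput 3 (.var wCount) (.const 0)))) <|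
  .nset wCount (.add (.var wCount) (.const 1))

/-- A bound for the cost of placing the sinks. -/
def placeCost (k K : ℕ) : ℕ := k * (stepCost K 8 + 80) + 8

section
variable {N : PathNetwork} {k K B : ℕ} {σ : Store}

lemma oracle_cmpTime (hB : 1 ≤ B) (hm : N.Mem k K σ) :
    Oracle N k K B cmpTime 8 (Agree σ) (fun σ' t => t = σ'.rvar rTime) where
  mem h := hm.agree h.agreeOut
  agree h h' := h'.trans h
  known h := by rw [h.rvar _ (by omega)]
  run := by
    intro σ₁ h
    refine (Run.ite (c₁ := 2) (c₂ := 2) (fun hb => Run.nset ?_ ?_) (fun hb => Run.nset ?_ ?_)).mono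
      (by simp [BExpr.cost, RExpr.cost]) (fun _ h => h)
    · exact Nat.zero_le _
    · refine ⟨h.setN (by omega), ?_, fun t => id, .inr ⟨by simp [NExpr.eval], ?_⟩⟩
      · constructor <;> simp [NExpr.eval]
      · rintro _ rfl
        exact hb
    · exact hB
    · refine ⟨h.setN (by omega), ?_, fun t => id, .inl ⟨by simp [NExpr.eval], ?_⟩⟩
      · constructor <;> simp [NExpr.eval]
      · rintro _ rfl
        exact not_lt.1 hb

lemma run_writeSink (hm : N.Mem k K σ) {t : ℝ} {a h b : ℕ} (ht : σ.rvar rTime = t)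
    (ha : σ.nvar wStart = a) (han : a ≤ N.n) (hh : σ.nvar wSink = h) (hhn : h ≤ N.n)
    (hhB : h ≤ B) (hb : σ.nvar wPos = b) (hl : σ.rvar rLeft = rangeMax N.keyL a (h + 1)) :
    Run B writeSink σ 40 fun σ' => AgreeOut σ σ' ∧ σ'.nvar = σ.nvar ∧
      (∀ j, σ'.narr 0 j = if j = σ.nvar wCount then h else σ.narr 0 j) ∧
      ∀ j, σ'.rarr 3 j = if j = σ.nvar wCount then N.greedyOff t a h b else σ.rarr 3 j := by
  refine (Run.seq (c₁ := 3) (Run.nput (by simpa [NExpr.eval, hh] using hhB)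
    (Run.ite (c₁ := 22) (c₂ := 3) (fun hlt => Run.seq (c₁ := 12) (c₂ := 10) (Run.rset
      (Run.seq (c₁ := 7) (c₂ := 3) ((Run.ite (c₁ := 2) (c₂ := 1)
        (fun hneg => Run.rset (Run.rput ?_))
        (fun hneg => Run.skip (Run.rput ?_))).mono ?_ (fun _ h => h)))))
      (fun hlt => Run.rput ?_)))).mono ?_ (fun _ h => h)
  · simp [BExpr.holds, RExpr.eval, NExpr.eval, ht, ha, hh, hl, hb, hm.load a han, hm.travel h hhn,
      hm.tau] at hneg hlt ⊢
    refine ⟨⟨fun x hx => ?_, fun x hx => ?_, fun x hx => ?_⟩, fun j => ?_⟩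
    · simp
    · simp [show x ≠ 3 by omega]
    · ext; simp [hx]
    · rw [PathNetwork.greedyOff, if_pos hlt, max_eq_left hneg.le]
  · simp [BExpr.holds, RExpr.eval, NExpr.eval, ht, ha, hh, hl, hb, hm.load a han, hm.travel h hhn,
      hm.tau] at hneg hlt ⊢
    refine ⟨⟨fun x hx => ?_, fun x hx => ?_, fun x hx => ?_⟩, fun j => ?_⟩
    · simp
    · simp [show x ≠ 3 by omega]
    · ext; simp [hx]
    · rw [PathNetwork.greedyOff, if_pos hlt, max_eq_right hneg]
  · simp [BExpr.cost, RExpr.cost]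
  · simp [BExpr.holds, RExpr.eval, NExpr.eval, hh, hb] at hlt ⊢
    refine ⟨⟨fun x hx => ?_, fun x hx => ?_, fun x hx => ?_⟩, fun j => ?_⟩
    · simp
    · simp
    · ext; simp [hx]
    · rw [PathNetwork.greedyOff, if_neg (show ¬ h + 1 < b by omega)]
  · simp [BExpr.cost, NExpr.cost]

/-- The greedy placement is carried out by the program, and the sinks are written down. -/
theorem run_placeSinks (hU : N.IsUniform) (hB : 2 * 2 ^ K ≤ B) (hkB : k ≤ B) (hK : N.n < 2 ^ K)
    (hm : N.Mem k K σ) {t : ℝ} (ht : σ.rvar rTime = t) (ht0 : 0 ≤ t) :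
    Run B placeSinks σ (placeCost k K) fun σ' => AgreeOut σ σ' ∧ ∃ a, σ'.nvar wStart = a ∧
      N.Greedy t k a ∧ N.Covers t (σ'.narr 0) (σ'.rarr 3) k a := by
  have hloop := Run.loop (B := B) (b := .nlt (.var wCount) (.var wK))
    (p := .seq (.ite (.nlt (.var wStart) (.var wN))
    (.seq (greedyStep cmpTime) (.seq writeSink (.nset wStart (.var wPos))))
    (.seq (.nput 0 (.var wCount) (.const 0)) (.rput 3 (.var wCount) (.const 0)))) <|
    .nset wCount (.add (.var wCount) (.const 1))) (cb := stepCost K 8 + 60)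
    (Q := fun σ' => AgreeOut σ σ' ∧ ∃ a, σ'.nvar wStart = a ∧
      N.Greedy t k a ∧ N.Covers t (σ'.narr 0) (σ'.rarr 3) k a)
    (fun e σ' => AgreeOut σ σ' ∧ ∃ a c, σ'.nvar wStart = a ∧ σ'.nvar wCount = c ∧ c + e = k ∧
      N.Greedy t c a ∧ N.Covers t (σ'.narr 0) (σ'.rarr 3) c a) ?_ ?_ k
  · refine (Run.seq (c₁ := 2) (Run.nset (Nat.zero_le _) (Run.seq (c₁ := 2)
      (Run.nset (Nat.zero_le _) (hloop _ ⟨?_, 0, 0, ?_, ?_, by omega, .zero, .zero⟩))))).mono ?_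
      (fun _ h => h)
    · exact (((Agree.refl σ).setN (by omega)).setN (by omega)).agreeOut
    · simp [NExpr.eval]
    · simp [NExpr.eval]
    · have : k * (stepCost K 8 + 60 + (BExpr.nlt (.var wCount) (.var wK)).cost + 1) ≤
        k * (stepCost K 8 + 80) := Nat.mul_le_mul_left _ (by simp [BExpr.cost, NExpr.cost])
      simp only [placeCost, BExpr.cost, NExpr.cost] at this ⊢
      omega
  · rintro e σ₁ ⟨hag, a, c, ha, hc, hce, hg, hcov⟩ hb
    have hm₁ := hm.agree hag
    have ht₁ : σ₁.rvar rTime = t := (hag.rvar _ (by omega)).trans ht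
    simp only [BExpr.holds, NExpr.eval, hc, hm₁.k] at hb
    refine ⟨e - 1, by omega, ?_⟩
    refine (Run.seq (c₂ := 4) (Run.mono (c₁ := stepCost K 8 + 52) (R := fun σ' => AgreeOut σ σ' ∧
      ∃ a, σ'.nvar wStart = a ∧ σ'.nvar wCount = c ∧ N.Greedy t (c + 1) a ∧
      N.Covers t (σ'.narr 0) (σ'.rarr 3) (c + 1) a) ?_ le_rfl ?_)).mono (by omega) (fun _ h => h)
    · refine (Run.ite (c₁ := stepCost K 8 + (40 + 2)) (c₂ := 6) (fun hlt => ?_)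
        (fun hlt => ?_)).mono ?_ (fun _ h => h)
      · simp only [BExpr.holds, NExpr.eval, ha, hm₁.n] at hlt
        refine Run.seq ((run_greedyStep (oracle_cmpTime (by
          have : 0 < 2 ^ K := by positivity
          omega) hm₁) hB hK (Agree.refl _) ha hlt).mono le_rfl ?_)
        rintro σ₂ ⟨hag₂, ha₂, hc₂, -, h, b, hh, hb₂, hl, hstep⟩
        have hstep := hstep _ rfl
        have ht₂ : σ₂.rvar rTime = t := (hag₂.rvar _ (by omega)).trans ht₁
        rw [ht₂] at hstep
        have h1 := hstep.le
        have h2 := hstep.lt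
        have h3 := hstep.le_n
        refine Run.seq ((run_writeSink (hm₁.agree hag₂.agreeOut) ht₂ ha₂ hlt.le hh (by omega)
          (by omega) hb₂ hl).mono le_rfl ?_)
        rintro σ₃ ⟨hag₃, hn₃, ho₃, hf₃⟩
        rw [hc₂, hc] at ho₃ hf₃
        have he : (NExpr.var wPos).eval σ₃ = b := by simp only [NExpr.eval, hn₃, hb₂]
        refine Run.nset (by omega) ⟨?_, b, ?_, ?_, ?_, ?_⟩
        · exact ((hag.trans hag₂.agreeOut).trans hag₃).trans
            ((Agree.refl σ₃).setN (by omega)).agreeOut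
        · simp [he]
        · simp [hn₃, hc₂, hc]
        · exact hg.step hlt hstep
        · refine .succ (hcov.congr fun i hi => ?_) (h1.trans h2.le) ?_
          · simp only [Store.setN_narr, Store.setN_rarr, ho₃, hf₃, if_neg hi.ne, hag₂.narr,
              hag₂.rarr, and_self]
          · simp only [Store.setN_narr, Store.setN_rarr, ho₃, hf₃, if_true]
            exact hstep.serves hU ht0
      · simp only [BExpr.holds, NExpr.eval, ha, hm₁.n] at hlt
        obtain rfl : a = N.n := le_antisymm hg.le_n (not_lt.1 hlt)
        refine (Run.seq (c₁ := 3) (Run.nput (Nat.zero_le _) (Run.rput ?_))).mono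
          (by simp [RExpr.cost, NExpr.cost]) (fun _ h => h)
        refine ⟨hag.trans ⟨?_, ?_, ?_⟩, N.n, ?_, ?_, hg.done, ?_⟩
        · simp
        · simp
        · intro x hx
          ext
          simp [hx]
        · simpa using ha
        · simpa using hc
        · refine .succ (hcov.congr fun i hi => ?_) le_rfl ?_
          · simp [NExpr.eval, hc, hi.ne]
          · simpa [NExpr.eval, RExpr.eval, hc] using N.serves_empty t N.n
      · simp only [BExpr.cost, NExpr.cost]
        omega
    · rintro σ₂ ⟨hag₂, a', ha', hc', hg', hcov'⟩
      have he : (NExpr.add (.var wCount) (.const 1)).eval σ₂ = c + 1 := by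
        simp only [NExpr.eval, hc']
      refine Run.nset (by omega) ⟨hag₂.trans ((Agree.refl σ₂).setN (by omega)).agreeOut, a', c + 1,
        ?_, ?_, by omega, hg', hcov'⟩
      · simpa using ha'
      · simp [he]
  · rintro e σ₁ ⟨hag, a, c, ha, hc, hce, hg, hcov⟩ hb
    simp only [BExpr.holds, NExpr.eval, hc, (hm.agree hag).k] at hb
    obtain rfl : c = k := by omega
    exact ⟨hag, a, ha, hg, hcov⟩

end

end RealRAM

/-! ### Parametric search for the optimal time -/

namespace RealRAM

/-- Save the variables of the search in progress. -/
def saveSearch : Prog :=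
  .seq (.nset wPosSaved (.var wPos)) <| .seq (.nset wStepSaved (.var wStep)) <|
  .seq (.nset wStartSaved (.var wStart)) <| .seq (.nset wCountSaved (.var wCount)) <|
  .seq (.nset wSinkSaved (.var wSink)) <| .seq (.rset rMaxSaved (.var rMax)) <|
  .seq (.rset rNewSaved (.var rNew)) (.rset rLeftSaved (.var rLeft))

/-- Restore the variables of the search in progress. -/
def restoreSearch : Prog :=
  .seq (.nset wPos (.var wPosSaved)) <| .seq (.nset wStep (.var wStepSaved)) <|
  .seq (.nset wStart (.var wStartSaved)) <| .seq (.nset wCount (.var wCountSaved)) <|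
  .seq (.nset wSink (.var wSinkSaved)) <| .seq (.rset rMax (.var rMaxSaved)) <|
  .seq (.rset rNew (.var rNewSaved)) (.rset rLeft (.var rLeftSaved))

/-- Compare the threshold with the optimal time, which lies in the half-open interval from `rLo`
(excluded) to `rHi` (included): if the bounds do not decide the comparison, test the feasibility of
the threshold and adjust a bound. -/
def cmpOptimal : Prog :=
  .ite (.not (.rlt (.var rLo) (.var rThr))) (.nset wFlag (.const 1)) <|
  .ite (.not (.rlt (.var rThr) (.var rHi))) (.nset wFlag (.const 0)) <|
  .seq saveSearch <| .seq (.rset rTime (.var rThr)) <| .seq placeSinks <|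
  .seq (.ite (.nlt (.var wStart) (.var wN))
    (.seq (.rset rLo (.var rTime)) (.nset wFlag (.const 1)))
    (.seq (.rset rHi (.var rTime)) (.nset wFlag (.const 0)))) restoreSearch

/-- Find the optimal time by carrying out the greedy placement for it, and place the sinks. -/
def optimize : Prog :=
  .seq (.rset rLo (.const 0)) <|
  .seq (.rset rHi (.add (.get aLoad (.var wN)) (.get aTravel (.var wN)))) <|
  .seq (.nset wStart (.const 0)) <| .seq (.nset wCount (.const 0)) <|
  .seq (.loop (.nlt (.var wCount) (.var wK)) <|
    .seq (.ite (.nlt (.var wStart) (.var wN))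
      (.seq (greedyStep cmpOptimal) (.nset wStart (.var wPos))) .skip) <|
    .nset wCount (.add (.var wCount) (.const 1))) <|
  .seq (.rset rTime (.var rHi)) placeSinks

/-- Place the sinks for time `0` or, if this fails, for the optimal time. -/
def solve : Prog :=
  .seq (.rset rTime (.const 0)) <| .seq placeSinks <|
  .ite (.nlt (.var wStart) (.var wN)) optimize .skip

/-- A bound for the cost of `solve`. -/
def solveCost (k K : ℕ) : ℕ :=
  k * (stepCost K (placeCost k K + 100) + 30) + 2 * placeCost k K + 60

section
variable {N : PathNetwork} {k K B : ℕ} {σ : Store}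

/-- The invariant of the parametric search. -/
structure Bounds (N : PathNetwork) (k K : ℕ) (σ : Store) : Prop where
  mem : N.Mem k K σ
  lo_nonneg : 0 ≤ σ.rvar rLo
  lo : ¬ N.Feasible (σ.rvar rLo) k
  hi : N.Feasible (σ.rvar rHi) k

/-- The time `t` lies between the two bounds, of which the lower one is admitted. -/
def Between (σ : Store) (t : ℝ) : Prop := σ.rvar rLo ≤ t ∧ t < σ.rvar rHi

/-- The variables of the search in progress in the memory `σ` are saved in the memory `σ'`. -/
structure Saved (σ σ' : Store) : Prop where
  pos : σ'.nvar wPosSaved = σ.nvar wPos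
  step : σ'.nvar wStepSaved = σ.nvar wStep
  start : σ'.nvar wStartSaved = σ.nvar wStart
  count : σ'.nvar wCountSaved = σ.nvar wCount
  sink : σ'.nvar wSinkSaved = σ.nvar wSink
  max : σ'.rvar rMaxSaved = σ.rvar rMax
  new : σ'.rvar rNewSaved = σ.rvar rNew
  left : σ'.rvar rLeftSaved = σ.rvar rLeft

lemma Saved.agreeOut {σ' σ'' : Store} (h : Saved σ σ') (ha : AgreeOut σ' σ'') : Saved σ σ'' where
  pos := (ha.nvar _ (by omega)).trans h.pos
  step := (ha.nvar _ (by omega)).trans h.step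
  start := (ha.nvar _ (by omega)).trans h.start
  count := (ha.nvar _ (by omega)).trans h.count
  sink := (ha.nvar _ (by omega)).trans h.sink
  max := (ha.rvar _ (by omega)).trans h.max
  new := (ha.rvar _ (by omega)).trans h.new
  left := (ha.rvar _ (by omega)).trans h.left

lemma Bounds.agree {σ' : Store} (h : Bounds N k K σ) (ha : Agree σ σ') : Bounds N k K σ' := by
  have h1 := ha.rvar rLo (by omega)
  have h2 := ha.rvar rHi (by omega)
  exact ⟨h.mem.agree ha.agreeOut, by rw [h1]; exact h.lo_nonneg, by rw [h1]; exact h.lo,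
    by rw [h2]; exact h.hi⟩

lemma Between.agree_iff {σ' : Store} {t : ℝ} (ha : Agree σ σ') : Between σ' t ↔ Between σ t := by
  rw [Between, Between, ha.rvar rLo (by omega), ha.rvar rHi (by omega)]

lemma mem_setR (hm : N.Mem k K σ) {x : ℕ} (hx : x ≠ rTau) (u : ℝ) : N.Mem k K (σ.setR x u) :=
  ⟨hm.n, hm.k, hm.size, by rw [Store.setR_rvar, if_neg (Ne.symm hx)]; exact hm.tau, hm.load,
    hm.travel, hm.keyL, hm.keyR⟩

lemma run_saveSearch (hm : N.Mem k K σ) : Run B saveSearch σ 16 fun σ' =>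
    N.Mem k K σ' ∧ Saved σ σ' ∧ σ'.rvar rLo = σ.rvar rLo ∧ σ'.rvar rHi = σ.rvar rHi ∧
      σ'.rvar rThr = σ.rvar rThr := by
  refine Run.of_bounded fun hσ => ?_
  refine Run.seq (c₁ := 2) (c₂ := 14) (Run.nset ?_ <| Run.seq (c₁ := 2) (c₂ := 12) <|
    Run.nset ?_ <| Run.seq (c₁ := 2) (c₂ := 10) <| Run.nset ?_ <|
    Run.seq (c₁ := 2) (c₂ := 8) <| Run.nset ?_ <| Run.seq (c₁ := 2) (c₂ := 6) <|
    Run.nset ?_ <| Run.seq (c₁ := 2) (c₂ := 4) <| Run.rset <|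
    Run.seq (c₁ := 2) (c₂ := 2) <| Run.rset <| Run.rset ⟨?_, ?_, ?_, ?_, ?_⟩)
  · simpa [NExpr.eval] using hσ wPos
  · simpa [NExpr.eval] using hσ wStep
  · simpa [NExpr.eval] using hσ wStart
  · simpa [NExpr.eval] using hσ wCount
  · simpa [NExpr.eval] using hσ wSink
  · exact ⟨by simpa using hm.n, by simpa using hm.k, by simpa using hm.size, by simpa using hm.tau,
      hm.load, hm.travel, hm.keyL, hm.keyR⟩
  · constructor <;> simp [NExpr.eval, RExpr.eval]
  all_goals simp [RExpr.eval]

lemma run_restoreSearch {σ' : Store} (h : Saved σ σ') : Run B restoreSearch σ' 16 fun σ'' =>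
    Agree σ' σ'' ∧ Keep σ σ'' ∧ σ''.nvar wFlag = σ'.nvar wFlag := by
  refine Run.of_bounded fun hσ => ?_
  refine Run.seq (c₁ := 2) (c₂ := 14) (Run.nset ?_ <| Run.seq (c₁ := 2) (c₂ := 12) <|
    Run.nset ?_ <| Run.seq (c₁ := 2) (c₂ := 10) <| Run.nset ?_ <|
    Run.seq (c₁ := 2) (c₂ := 8) <| Run.nset ?_ <| Run.seq (c₁ := 2) (c₂ := 6) <|
    Run.nset ?_ <| Run.seq (c₁ := 2) (c₂ := 4) <| Run.rset <|
    Run.seq (c₁ := 2) (c₂ := 2) <| Run.rset <| Run.rset ⟨?_, ?_, ?_⟩)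
  · simpa [NExpr.eval] using hσ wPosSaved
  · simpa [NExpr.eval] using hσ wStepSaved
  · simpa [NExpr.eval] using hσ wStartSaved
  · simpa [NExpr.eval] using hσ wCountSaved
  · simpa [NExpr.eval] using hσ wSinkSaved
  · exact (((((((((Agree.refl _).setN (by omega)).setN (by omega)).setN (by omega)).setN
      (by omega)).setN (by omega)).setR (by omega)).setR (by omega)).setR (by omega))
  · constructor <;>
      simp [NExpr.eval, RExpr.eval, h.pos, h.step, h.start, h.count, h.sink, h.max, h.new, h.left]
  · simp

/-- If the bounds do not decide a comparison, the threshold becomes one of them, and no time between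
the new bounds is on the other side of it. -/
lemma oracle_cmpOptimal (hU : N.IsUniform) (hB : 2 * 2 ^ K ≤ B) (hkB : k ≤ B)
    (hK : N.n < 2 ^ K) :
    Oracle N k K B cmpOptimal (placeCost k K + 100) (Bounds N k K) Between where
  mem h := h.mem
  agree h h' := h'.agree h
  known h := Between.agree_iff h
  run := by
    intro σ hI
    have hB1 : 1 ≤ B := by
      have : 0 < 2 ^ K := by positivity
      omega
    have hset : ∀ {x}, Bounds N k K (σ.setN wFlag x) ∧ Keep σ (σ.setN wFlag x) ∧
        ∀ t, Between (σ.setN wFlag x) t → Between σ t := by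
      intro x
      refine ⟨⟨?_, hI.lo_nonneg, hI.lo, hI.hi⟩, ?_, fun t => id⟩
      · exact hI.mem.agree ((Agree.refl σ).setN (by omega)).agreeOut
      · constructor <;> simp
    refine (Run.ite (c₁ := 2) (c₂ := placeCost k K + 80) (fun hb => Run.nset hB1 ?_) (fun hb =>
      (Run.ite (c₁ := 2) (c₂ := placeCost k K + 60) (fun hb' => Run.nset (Nat.zero_le _) ?_)
      (fun hb' => ?_)).mono ?_ (fun _ h => h))).mono ?_ (fun _ h => h)
    · simp only [BExpr.holds, RExpr.eval, not_lt] at hb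
      exact ⟨hset.1, hset.2.1, hset.2.2, .inl ⟨by simp [NExpr.eval], fun t ht => hb.trans ht.1⟩⟩
    · simp only [BExpr.holds, RExpr.eval, not_lt] at hb'
      exact ⟨hset.1, hset.2.1, hset.2.2,
        .inr ⟨by simp [NExpr.eval], fun t ht => ht.2.trans_le hb'⟩⟩
    · simp only [BExpr.holds, RExpr.eval, not_lt, not_le] at hb hb'
      refine (Run.seq (c₁ := 16) (c₂ := placeCost k K + 40) ((run_saveSearch hI.mem).mono le_rfl
        ?_)).mono (by omega) (fun _ h => h)
      rintro σ₁ ⟨hm₁, hs₁, hlo₁, hhi₁, hthr₁⟩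
      refine (Run.seq (c₁ := 2) (Run.rset (Run.seq (c₂ := 36)
        ((run_placeSinks (t := σ.rvar rThr) hU hB hkB hK
        ?_ ?_ ?_).mono le_rfl ?_)))).mono (by omega) (fun _ h => h)
      · exact mem_setR hm₁ (by norm_num) _
      · simpa [RExpr.eval] using hthr₁
      · exact hI.lo_nonneg.trans hb.le
      · rintro σ₂ ⟨hag₂, a, ha, hg, -⟩
        have han := hg.le_n
        have hfeas := hg.eq_n_iff hU (hI.lo_nonneg.trans hb.le)
        have hm₂ := (mem_setR hm₁ (by norm_num) _).agree hag₂
        have hs₂ : Saved σ σ₂ := by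
          refine Saved.agreeOut ?_ hag₂
          constructor <;>
            simp [hs₁.pos, hs₁.step, hs₁.start, hs₁.count, hs₁.sink, hs₁.max, hs₁.new, hs₁.left]
        have hlo₂ : σ₂.rvar rLo = σ.rvar rLo := by
          rw [hag₂.rvar _ (by omega)]; simpa using hlo₁
        have hhi₂ : σ₂.rvar rHi = σ.rvar rHi := by
          rw [hag₂.rvar _ (by omega)]; simpa using hhi₁
        have ht₂ : σ₂.rvar rTime = σ.rvar rThr := by
          rw [hag₂.rvar _ (by omega)]; simpa [RExpr.eval] using hthr₁
        refine (Run.seq (c₁ := 12) (c₂ := 16) (Run.mono (R := fun σ₃ => Bounds N k K σ₃ ∧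
          Saved σ σ₃ ∧ (∀ t, Between σ₃ t → Between σ t) ∧
          ((σ₃.nvar wFlag = 1 ∧ ∀ t, Between σ₃ t → σ.rvar rThr ≤ t) ∨
            (σ₃.nvar wFlag = 0 ∧ ∀ t, Between σ₃ t → t < σ.rvar rThr)))
          (Run.ite (c₁ := 4) (c₂ := 4) (fun hlt => Run.seq (c₁ := 2) (c₂ := 2)
            (Run.rset (Run.nset hB1 ?_)))
          (fun hlt => Run.seq (c₁ := 2) (c₂ := 2) (Run.rset (Run.nset (Nat.zero_le _) ?_)))) ?_
          ?_)).mono (by omega) (fun _ h => h)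
        · simp only [BExpr.holds, NExpr.eval, ha, hm₂.n] at hlt
          have hnot : ¬ N.Feasible (σ.rvar rThr) k := fun h => hlt.ne (hfeas.2 h)
          refine ⟨⟨(mem_setR hm₂ (by norm_num) _).agree
            ((Agree.refl _).setN (by omega)).agreeOut, ?_, ?_, ?_⟩, ?_, ?_, .inl ⟨?_, ?_⟩⟩
          · simpa [RExpr.eval, ht₂] using hI.lo_nonneg.trans hb.le
          · simpa [RExpr.eval, ht₂] using hnot
          · simpa [hhi₂] using hI.hi
          · constructor <;>
              simp [hs₂.pos, hs₂.step, hs₂.start, hs₂.count, hs₂.sink, hs₂.max, hs₂.new, hs₂.left]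
          · intro t ht
            simp only [Between, RExpr.eval, Store.setN_rvar, Store.setR_rvar, ht₂, hhi₂] at ht ⊢
            norm_num [hhi₂] at ht
            exact ⟨hb.le.trans ht.1, ht.2⟩
          · simp [NExpr.eval]
          · intro t ht
            simp only [Between, RExpr.eval, Store.setN_rvar, Store.setR_rvar, ht₂] at ht
            simpa using ht.1
        · simp only [BExpr.holds, NExpr.eval, ha, hm₂.n] at hlt
          have hyes : N.Feasible (σ.rvar rThr) k := hfeas.1 (by omega)
          refine ⟨⟨(mem_setR hm₂ (by norm_num) _).agree
            ((Agree.refl _).setN (by omega)).agreeOut, ?_, ?_, ?_⟩, ?_, ?_, .inr ⟨?_, ?_⟩⟩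
          · simpa [hlo₂] using hI.lo_nonneg
          · simpa [hlo₂] using hI.lo
          · simpa [RExpr.eval, ht₂] using hyes
          · constructor <;>
              simp [hs₂.pos, hs₂.step, hs₂.start, hs₂.count, hs₂.sink, hs₂.max, hs₂.new, hs₂.left]
          · intro t ht
            simp only [Between, RExpr.eval, Store.setN_rvar, Store.setR_rvar, ht₂] at ht ⊢
            norm_num [hlo₂] at ht
            exact ⟨ht.1, ht.2.trans hb'⟩
          · simp [NExpr.eval]
          · intro t ht
            simp only [Between, RExpr.eval, Store.setN_rvar, Store.setR_rvar, ht₂] at ht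
            simpa using ht.2
        · simp [BExpr.cost, NExpr.cost]
        · rintro σ₃ ⟨hI₃, hs₃, hk₃, hr₃⟩
          refine (run_restoreSearch hs₃).mono le_rfl ?_
          rintro σ₄ ⟨hag₄, hkeep, hfl⟩
          have hbt : ∀ t, Between σ₄ t → Between σ₃ t := fun t => (Between.agree_iff hag₄).1
          rw [hfl]
          exact ⟨hI₃.agree hag₄, hkeep, fun t ht => hk₃ t (hbt t ht),
            hr₃.imp (fun h => ⟨h.1, fun t ht => h.2 t (hbt t ht)⟩)
              (fun h => ⟨h.1, fun t ht => h.2 t (hbt t ht)⟩)⟩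
    · simp [BExpr.cost, RExpr.cost]; omega
    · simp [BExpr.cost, RExpr.cost]; omega

/-- When the greedy placement is the same for all times from `lo` up to `hi`, the lower bound cannot
be infeasible if a time below `hi` is feasible. -/
lemma hi_le_of_greedy (hU : N.IsUniform) {lo hi : ℝ} (hlo0 : 0 ≤ lo) (hlo : ¬ N.Feasible lo k)
    {a : ℕ} (hg : ∀ t, lo ≤ t ∧ t < hi → N.Greedy t k a) {t : ℝ} (ht : N.Feasible t k) :
    hi ≤ t := by
  by_contra! hlt
  have hlot : lo ≤ t := by
    by_contra! h
    exact hlo (ht.mono hU h.le)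
  have ha := ((hg t ⟨hlot, hlt⟩).eq_n_iff hU ht.nonneg).2 ht
  exact hlo (((hg lo ⟨le_rfl, hlot.trans_lt hlt⟩).eq_n_iff hU hlo0).1 ha)

lemma run_optimize (hU : N.IsUniform) (hk : 1 ≤ k) (hB : 2 * 2 ^ K ≤ B) (hkB : k ≤ B)
    (hK : N.n < 2 ^ K) (hm : N.Mem k K σ) (h0 : ¬ N.Feasible 0 k) :
    Run B optimize σ (k * (stepCost K (placeCost k K + 100) + 30) + placeCost k K + 40) fun σ' =>
      ∃ t, (∀ t', N.Feasible t' k → t ≤ t') ∧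
        N.Covers t (σ'.narr 0) (σ'.rarr 3) k N.n := by
  have hO := oracle_cmpOptimal hU hB hkB hK
  have hloop := Run.loop (B := B) (b := .nlt (.var wCount) (.var wK))
    (p := .seq (.ite (.nlt (.var wStart) (.var wN))
      (.seq (greedyStep cmpOptimal) (.nset wStart (.var wPos))) .skip) <|
    .nset wCount (.add (.var wCount) (.const 1)))
    (cb := stepCost K (placeCost k K + 100) + 20)
    (Q := fun σ' => N.Mem k K σ' ∧ N.Feasible (σ'.rvar rHi) k ∧
      ∀ t', N.Feasible t' k → σ'.rvar rHi ≤ t')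
    (fun e σ' => Bounds N k K σ' ∧ ∃ a c, σ'.nvar wStart = a ∧ σ'.nvar wCount = c ∧ c + e = k ∧
      ∀ t, Between σ' t → N.Greedy t c a) ?_ ?_ k
  · have e1 : (RExpr.add (.get aLoad (.var wN)) (.get aTravel (.var wN))).eval
        (σ.setR rLo ((RExpr.const 0).eval σ)) = N.load N.n + N.travel N.n := by
      simp [RExpr.eval, NExpr.eval, hm.n, hm.load, hm.travel]
    refine (Run.seq (c₁ := 2) (Run.rset (Run.seq (c₁ := 6) (Run.rset (Run.seq (c₁ := 2)
      (Run.nset (Nat.zero_le _) (Run.seq (c₁ := 2) (Run.nset (Nat.zero_le _)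
      (Run.seq (c₂ := 2 + placeCost k K) ((hloop _ ⟨⟨?_, ?_, ?_, ?_⟩, 0, 0, ?_, ?_, by omega,
        fun t _ => .zero⟩).mono le_rfl ?_)))))))))).mono ?_
      (fun _ h => h)
    · exact (mem_setR (mem_setR hm (by norm_num) _) (by norm_num) _).agree
        (((Agree.refl _).setN (by omega)).setN (by omega)).agreeOut
    · simp [RExpr.eval]
    · simpa [RExpr.eval] using h0
    · rw [Store.setN_rvar, Store.setN_rvar, Store.setR_rvar, if_pos rfl, e1]
      exact PathNetwork.feasible_load_add_travel hU hk
    · simp [NExpr.eval]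
    · simp [NExpr.eval]
    · rintro σ₁ ⟨hm₁, hfe, hopt⟩
      refine Run.seq (c₁ := 2) (Run.rset ((run_placeSinks (t := σ₁.rvar rHi) hU hB hkB hK
        (mem_setR hm₁ (by norm_num) _) ?_ hfe.nonneg).mono le_rfl ?_))
      · simp [RExpr.eval]
      · rintro σ₂ ⟨-, a, -, hg, hcov⟩
        obtain rfl := (hg.eq_n_iff hU hfe.nonneg).2 hfe
        exact ⟨_, hopt, hcov⟩
    · have : k * (stepCost K (placeCost k K + 100) + 20 +
          (BExpr.nlt (.var wCount) (.var wK)).cost + 1) ≤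
        k * (stepCost K (placeCost k K + 100) + 30) :=
          Nat.mul_le_mul_left _ (by simp [BExpr.cost, NExpr.cost])
      simp only [BExpr.cost, NExpr.cost] at this ⊢
      omega
  · rintro e σ₁ ⟨hI, a, c, ha, hc, hce, hg⟩ hb
    simp only [BExpr.holds, NExpr.eval, hc, hI.mem.k] at hb
    refine ⟨e - 1, by omega, ?_⟩
    refine (Run.seq (c₂ := 4) (Run.mono (c₁ := stepCost K (placeCost k K + 100) + 12)
      (R := fun σ' => Bounds N k K σ' ∧
      ∃ a, σ'.nvar wStart = a ∧ σ'.nvar wCount = c ∧ ∀ t, Between σ' t → N.Greedy t (c + 1) a)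
      ?_ le_rfl ?_)).mono (by omega) (fun _ h => h)
    · refine (Run.ite (c₁ := stepCost K (placeCost k K + 100) + 2) (c₂ := 1) (fun hlt => ?_)
        (fun hlt => Run.skip ?_)).mono ?_ (fun _ h => h)
      · simp only [BExpr.holds, NExpr.eval, ha, hI.mem.n] at hlt
        refine Run.of_bounded fun _ => Run.seq ((run_greedyStep hO hB hK hI ha hlt).mono le_rfl ?_)
        rintro σ₂ ⟨hI₂, ha₂, hc₂, hk₂, h, b, hh, hb₂, -, hstep⟩
        refine Run.of_bounded fun hσ₂ => Run.nset (hσ₂ wPos) ⟨?_, b, ?_, ?_, ?_⟩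
        · exact hI₂.agree ((Agree.refl _).setN (by omega))
        · simpa [NExpr.eval] using hb₂
        · simpa [hc₂] using hc
        · intro t ht
          have ht₂ := (Between.agree_iff ((Agree.refl _).setN (by omega))).1 ht
          exact (hg t (hk₂ t ht₂)).step hlt (hstep t ht₂)
      · simp only [BExpr.holds, NExpr.eval, ha, hI.mem.n] at hlt
        refine ⟨hI, a, ha, hc, fun t ht => ?_⟩
        have hg' := hg t ht
        obtain rfl : a = N.n := le_antisymm hg'.le_n (not_lt.1 hlt)
        exact hg'.done
      · simp only [BExpr.cost, NExpr.cost]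
        omega
    · rintro σ₂ ⟨hI₂, a', ha', hc', hg'⟩
      have he : (NExpr.add (.var wCount) (.const 1)).eval σ₂ = c + 1 := by
        simp only [NExpr.eval, hc']
      refine Run.nset (by omega) ⟨hI₂.agree ((Agree.refl _).setN (by omega)), a', c + 1, ?_, ?_,
        by omega, fun t ht => hg' t ((Between.agree_iff ((Agree.refl _).setN (by omega))).1 ht)⟩
      · simpa using ha'
      · simp [he]
  · rintro e σ₁ ⟨hI, a, c, ha, hc, hce, hg⟩ hb
    simp only [BExpr.holds, NExpr.eval, hc, hI.mem.k] at hb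
    obtain rfl : c = k := by omega
    exact ⟨hI.mem, hI.hi, fun t' => hi_le_of_greedy hU hI.lo_nonneg hI.lo hg⟩

/-- The program places sinks that are optimal. -/
theorem run_solve (hU : N.IsUniform) (hk : 1 ≤ k) (hB : 2 * 2 ^ K ≤ B) (hkB : k ≤ B)
    (hK : N.n < 2 ^ K) (hm : N.Mem k K σ) :
    Run B solve σ (solveCost k K) fun σ' => ∃ t, (∀ t', N.Feasible t' k → t ≤ t') ∧
      N.Covers t (σ'.narr 0) (σ'.rarr 3) k N.n := by
  refine (Run.seq (c₁ := 2) (Run.rset (Run.seq ((run_placeSinks (t := 0) hU hB hkB hK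
    (mem_setR hm (by norm_num) _) ?_ le_rfl).mono le_rfl ?_)))).mono
    (c₁ := 2 + (placeCost k K + (4 + (k * (stepCost K (placeCost k K + 100) + 30) +
      placeCost k K + 40 + 1)))) ?_ (fun _ h => h)
  · simp [RExpr.eval]
  · rintro σ₁ ⟨hag, a, ha, hg, hcov⟩
    have hm₁ := (mem_setR hm (by norm_num) _).agree hag
    have hfeas := hg.eq_n_iff hU le_rfl
    have han := hg.le_n
    refine Run.ite (fun hlt => ?_) (fun hlt => Run.skip ?_)
    · simp only [BExpr.holds, NExpr.eval, ha, hm₁.n] at hlt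
      exact run_optimize hU hk hB hkB hK hm₁ fun h => hlt.ne (hfeas.2 h)
    · simp only [BExpr.holds, NExpr.eval, ha, hm₁.n] at hlt
      obtain rfl : a = N.n := by omega
      exact ⟨0, fun t' ht' => ht'.nonneg, hcov⟩
  · simp only [solveCost]
    omega

end

end RealRAM

/-! ### Preprocessing -/

namespace RealRAM

/-- Find a power of two above the number of vertices. -/
def initSize : Prog :=
  .seq (.nset wSize (.const 1)) <|
  .loop (.not (.nlt (.var wN) (.var wSize))) (.nset wSize (.mul (.const 2) (.var wSize)))

/-- Compute the loads, the travel times and the leaves of the two trees. -/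
def fillArrays : Prog :=
  .seq (.nset wIndex (.const 0)) <|
  .loop (.nlt (.var wIndex) (.var wSize)) <|
  .seq (.rput aLoad (.add (.var wIndex) (.const 1)) (.add (.get aLoad (.var wIndex))
    (.div (.get aWeight (.var wIndex)) (.get aCap (.const 0))))) <|
  .seq (.rput aTravel (.add (.var wIndex) (.const 1)) (.add (.get aTravel (.var wIndex))
    (.mul (.get aLen (.var wIndex)) (.var rTau)))) <|
  .seq (.rput aKeyL (.add (.var wSize) (.var wIndex))
    (.sub (.get aLoad (.add (.var wIndex) (.const 1))) (.get aTravel (.var wIndex)))) <|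
  .seq (.rput aKeyR (.add (.var wSize) (.var wIndex))
    (.sub (.get aTravel (.var wIndex)) (.get aLoad (.var wIndex)))) <|
  .nset wIndex (.add (.var wIndex) (.const 1))

/-- Compute the inner nodes of a tree of maxima from its leaves. -/
def buildTree (arr : ℕ) : Prog :=
  .seq (.nset wIndex (.var wSize)) <|
  .loop (.nlt (.const 1) (.var wIndex)) <|
  .seq (.nset wIndex (.sub (.var wIndex) (.const 1))) <|
  .seq (.rput arr (.var wIndex) (.get arr (.mul (.const 2) (.var wIndex)))) <|
  .ite (.rlt (.get arr (.var wIndex)) (.get arr (.add (.mul (.const 2) (.var wIndex)) (.const 1))))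
    (.rput arr (.var wIndex) (.get arr (.add (.mul (.const 2) (.var wIndex)) (.const 1)))) .skip

/-- The algorithm: preprocessing and parametric search. -/
def sinkProgram : Prog :=
  .seq initSize <| .seq fillArrays <| .seq (buildTree aKeyL) <| .seq (buildTree aKeyR) solve

section
variable {N : PathNetwork} {k K B : ℕ} {σ : Store}

/-- The part of the input that the preprocessing reads. -/
structure InputMem (N : PathNetwork) (k : ℕ) (σ : Store) : Prop where
  n : σ.nvar wN = N.n
  k : σ.nvar wK = k
  tau : σ.rvar rTau = N.τ
  weight : ∀ i, σ.rarr aWeight i = N.inWeight i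
  len : ∀ i, σ.rarr aLen i = N.inLen i
  cap : σ.rarr aCap 0 = N.inCap

lemma inputMem_input (N : PathNetwork) (k : ℕ) : InputMem N k (N.input k) := by
  constructor
  · simp [PathNetwork.input]
  · simp [PathNetwork.input]
  · simp [PathNetwork.input]
  · intro i
    simp [PathNetwork.input, PathNetwork.inWeight]
  · intro i
    simp [PathNetwork.input, PathNetwork.inLen]
  · simp [PathNetwork.input, PathNetwork.inCap]

lemma run_initSize (hB : 2 * N.n ≤ B) (hi : InputMem N k σ) :
    Run B initSize σ (N.n * 9 + 7) fun σ' => InputMem N k σ' ∧ σ'.rarr = σ.rarr ∧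
      ∃ K, σ'.nvar wSize = 2 ^ K ∧ N.n < 2 ^ K ∧ 2 ^ K ≤ 2 * N.n := by
  have hn := N.n_pos
  have hset : ∀ {σ : Store} {x}, InputMem N k σ → InputMem N k (σ.setN wSize x) := fun h =>
    ⟨by simpa using h.n, by simpa using h.k, h.tau, h.weight, h.len, h.cap⟩
  refine (Run.seq (c₁ := 2) (Run.nset (by simp only [NExpr.eval]; omega)
    (Run.loop (cb := 4) (fun e σ' =>
      InputMem N k σ' ∧ σ'.rarr = σ.rarr ∧ ∃ K, σ'.nvar wSize = 2 ^ K ∧ 2 ^ K ≤ 2 * N.n ∧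
        N.n < 2 ^ K + e) ?_ ?_ N.n _ ⟨hset hi, rfl, 0, ?_, ?_, ?_⟩))).mono ?_ (fun _ h => h)
  · rintro e σ₁ ⟨hi₁, hr, K, hs, hle, he⟩ hb
    simp only [BExpr.holds, NExpr.eval, hi₁.n, hs, not_lt] at hb
    have hev : (NExpr.mul (.const 2) (.var wSize)).eval σ₁ = 2 ^ (K + 1) := by
      simp only [NExpr.eval, hs, pow_succ]
      ring
    have h2 : 2 ^ (K + 1) = 2 * 2 ^ K := by ring
    have h0 : 0 < 2 ^ K := by positivity
    refine ⟨e - 1, by omega, Run.nset (by omega) ⟨hset hi₁, hr, K + 1, ?_, by omega, by omega⟩⟩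
    simp [hev]
  · rintro e σ₁ ⟨hi₁, hr, K, hs, hle, he⟩ hb
    simp only [BExpr.holds, NExpr.eval, hi₁.n, hs, not_not] at hb
    exact ⟨hi₁, hr, K, hs, hb, hle⟩
  · simp [NExpr.eval]
  · omega
  · omega
  · simp only [BExpr.cost, NExpr.cost]
    omega

lemma run_fillArrays (hB : 2 ^ K ≤ B) (hi : InputMem N k σ) (hs : σ.nvar wSize = 2 ^ K)
    (hK : N.n < 2 ^ K) (hl : σ.rarr aLoad 0 = 0) (ht : σ.rarr aTravel 0 = 0) :
    Run B fillArrays σ (2 ^ K * 60 + 6) fun σ' => InputMem N k σ' ∧ σ'.nvar wSize = 2 ^ K ∧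
      (∀ j, j ≤ N.n → σ'.rarr aLoad j = N.load j) ∧
      (∀ j, j ≤ N.n → σ'.rarr aTravel j = N.travel j) ∧
      (∀ j, j < 2 ^ K → σ'.rarr aKeyL (2 ^ K + j) = N.keyL j) ∧
      (∀ j, j < 2 ^ K → σ'.rarr aKeyR (2 ^ K + j) = N.keyR j) := by
  refine (Run.seq (c₁ := 2) (Run.nset (Nat.zero_le _) (Run.loop (cb := 50) (fun e σ' =>
    InputMem N k σ' ∧ σ'.nvar wSize = 2 ^ K ∧ ∃ i, σ'.nvar wIndex = i ∧ i + e = 2 ^ K ∧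
      (∀ j, j ≤ i → σ'.rarr aLoad j = N.load j) ∧
      (∀ j, j ≤ i → σ'.rarr aTravel j = N.travel j) ∧
      (∀ j, j < i → σ'.rarr aKeyL (2 ^ K + j) = N.keyL j) ∧
      (∀ j, j < i → σ'.rarr aKeyR (2 ^ K + j) = N.keyR j)) ?_ ?_ (2 ^ K) _
      ⟨?_, ?_, 0, ?_, by omega, ?_, ?_, ?_, ?_⟩))).mono ?_ (fun _ h => h)
  · rintro e σ₁ ⟨hi₁, hs₁, i, hx, he, h1, h2, h3, h4⟩ hb
    simp only [BExpr.holds, NExpr.eval, hx, hs₁] at hb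
    refine ⟨e - 1, by omega, ?_⟩
    have hload := N.load_succ i
    have htrav := N.travel_succ i
    refine Run.mono (Run.seq (c₁ := 12) (c₂ := 35) <| Run.rput <| Run.seq (c₁ := 11) (c₂ := 24) <|
      Run.rput <| Run.seq (c₁ := 11) (c₂ := 13) <| Run.rput <| Run.seq (c₁ := 9) (c₂ := 4) <|
      Run.rput <| Run.nset ?_
        ⟨⟨?_, ?_, ?_, ?_, ?_, ?_⟩, ?_, i + 1, ?_, by omega, ?_, ?_, ?_, ?_⟩)
      (by norm_num) (fun _ h => h)
    · simp [NExpr.eval, hx]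
      omega
    · simpa using hi₁.n
    · simpa using hi₁.k
    · simpa using hi₁.tau
    · simpa using hi₁.weight
    · simpa using hi₁.len
    · simpa using hi₁.cap
    · simpa using hs₁
    · simp [NExpr.eval, hx]
    · intro j hj
      by_cases hji : j = i + 1
      · subst hji
        simp [NExpr.eval, RExpr.eval, hx, h1, hi₁.weight, hi₁.cap, hload]
      · simp [NExpr.eval, hx, hji, h1 j (by omega)]
    · intro j hj
      by_cases hji : j = i + 1
      · subst hji
        simp [NExpr.eval, RExpr.eval, hx, h2, hi₁.len, hi₁.tau, htrav]
      · simp [NExpr.eval, hx, hji, h2 j (by omega)]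
    · intro j hj
      by_cases hji : j = i
      · subst hji
        simp [NExpr.eval, RExpr.eval, hx, hs₁, h1, h2, hi₁.weight, hi₁.cap, PathNetwork.keyL, hload]
      · simp [NExpr.eval, hx, hs₁, hji, h3 j (by omega)]
    · intro j hj
      by_cases hji : j = i
      · subst hji
        simp [NExpr.eval, RExpr.eval, hx, hs₁, h1, h2, PathNetwork.keyR]
      · simp [NExpr.eval, hx, hs₁, hji, h4 j (by omega)]
  · rintro e σ₁ ⟨hi₁, hs₁, i, hx, he, h1, h2, h3, h4⟩ hb
    simp only [BExpr.holds, NExpr.eval, hx, hs₁] at hb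
    exact ⟨hi₁, hs₁, fun j hj => h1 j (by omega), fun j hj => h2 j (by omega),
      fun j hj => h3 j (by omega), fun j hj => h4 j (by omega)⟩
  · exact ⟨by simpa using hi.n, by simpa using hi.k, hi.tau, hi.weight, hi.len, hi.cap⟩
  · simpa using hs
  · simp [NExpr.eval]
  · intro j hj
    obtain rfl : j = 0 := by omega
    simpa [PathNetwork.load] using hl
  · intro j hj
    obtain rfl : j = 0 := by omega
    simpa [PathNetwork.travel] using ht
  · intro j hj
    omega
  · intro j hj
    omega
  · simp only [BExpr.cost, NExpr.cost]
    omega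

lemma run_buildTree {f : ℕ → ℝ} (arr : ℕ) (hB : 2 ^ K ≤ B) (hs : σ.nvar wSize = 2 ^ K)
    (hf : ∀ j, j < 2 ^ K → σ.rarr arr (2 ^ K + j) = f j) :
    Run B (buildTree arr) σ (2 ^ K * 50 + 6) fun σ' => (∀ x, x ≠ wIndex → σ'.nvar x = σ.nvar x) ∧
      σ'.rvar = σ.rvar ∧ (∀ a, a ≠ arr → σ'.rarr a = σ.rarr a) ∧ IsMaxTree f K (σ'.rarr arr) := by
  refine (Run.seq (c₁ := 2) (Run.nset (by simpa [NExpr.eval, hs] using hB)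
    (Run.loop (cb := 40) (fun e σ' =>
      (∀ x, x ≠ wIndex → σ'.nvar x = σ.nvar x) ∧ σ'.rvar = σ.rvar ∧
      (∀ a, a ≠ arr → σ'.rarr a = σ.rarr a) ∧ ∃ i, σ'.nvar wIndex = i ∧ i ≤ e ∧ 0 < i ∧
      i ≤ 2 ^ K ∧ ∀ j r, j ≤ K → r < 2 ^ (K - j) → i ≤ 2 ^ (K - j) + r →
        σ'.rarr arr (2 ^ (K - j) + r) = rangeMax f (r * 2 ^ j) ((r + 1) * 2 ^ j)) ?_ ?_ (2 ^ K) _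
      ⟨?_, ?_, ?_, 2 ^ K, ?_, le_rfl, by positivity, le_rfl, ?_⟩))).mono ?_
      (fun _ h => h)
  · rintro e σ₁ ⟨hn, hr, ha, i, hx, hie, hi0, hiK, hd⟩ hb
    simp only [BExpr.holds, NExpr.eval, hx] at hb
    refine ⟨e - 1, by omega, ?_⟩
    obtain ⟨v, rfl⟩ : ∃ v, i = v + 1 := ⟨i - 1, by omega⟩
    have hev : (NExpr.sub (.var wIndex) (.const 1)).eval σ₁ = v := by
      simp [NExpr.eval, hx]
    -- The new node is the maximum of its children.
    have hnode : ∀ j r, j ≤ K → r < 2 ^ (K - j) → v = 2 ^ (K - j) + r →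
        max (σ₁.rarr arr (2 * v)) (σ₁.rarr arr (2 * v + 1)) =
          rangeMax f (r * 2 ^ j) ((r + 1) * 2 ^ j) := by
      intro j r hj hrj hv
      obtain ⟨j, rfl⟩ : ∃ j', j = j' + 1 := Nat.exists_eq_succ_of_ne_zero (by
        rintro rfl
        simp at hv
        omega)
      have hp : 2 ^ (K - j) = 2 * 2 ^ (K - (j + 1)) := by
        rw [show K - j = K - (j + 1) + 1 by omega, pow_succ]
        ring
      have h1 := hd j (2 * r) (by omega) (by omega) (by omega)
      have h2 := hd j (2 * r + 1) (by omega) (by omega) (by omega)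
      rw [show 2 ^ (K - j) + 2 * r = 2 * v by omega] at h1
      rw [show 2 ^ (K - j) + (2 * r + 1) = 2 * v + 1 by omega] at h2
      have hpow : 0 < 2 ^ j := by positivity
      rw [h1, h2, max_rangeMax f (Nat.mul_le_mul_right _ (by omega))
        (Nat.mul_lt_mul_of_pos_right (by omega) hpow)]
      congr 1 <;> ring
    have hfin : ∀ σ' : Store, (σ'.nvar = (σ₁.setN wIndex v).nvar ∧ σ'.rvar = σ₁.rvar ∧
        ∀ a j, σ'.rarr a j = if a = arr then if j = v then
          max (σ₁.rarr arr (2 * v)) (σ₁.rarr arr (2 * v + 1)) else σ₁.rarr a j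
          else σ₁.rarr a j) → (∀ x, x ≠ wIndex → σ'.nvar x = σ.nvar x) ∧ σ'.rvar = σ.rvar ∧
      (∀ a, a ≠ arr → σ'.rarr a = σ.rarr a) ∧ ∃ i, σ'.nvar wIndex = i ∧ i ≤ e - 1 ∧ 0 < i ∧
      i ≤ 2 ^ K ∧ ∀ j r, j ≤ K → r < 2 ^ (K - j) → i ≤ 2 ^ (K - j) + r →
        σ'.rarr arr (2 ^ (K - j) + r) = rangeMax f (r * 2 ^ j) ((r + 1) * 2 ^ j) := by
      rintro σ' ⟨g1, g2, g3⟩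
      refine ⟨fun x hx' => ?_, g2.trans hr, fun a ha' => ?_, v, ?_, by omega, by omega, by omega,
        fun j r hj hrj hle => ?_⟩
      · rw [g1, Store.setN_nvar, if_neg hx', hn x hx']
      · ext j
        rw [g3, if_neg ha', ha a ha']
      · rw [g1, Store.setN_nvar, if_pos rfl]
      · rw [g3, if_pos rfl]
        split_ifs with hv
        · exact hnode j r hj hrj hv.symm
        · exact hd j r hj hrj (by omega)
    have hne : 2 * v + 1 ≠ v := by omega
    refine ((Run.seq (c₁ := 4) (Run.nset (by omega) (Run.seq (c₁ := 6) (Run.rput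
      (Run.ite (c₁ := 8) (c₂ := 1) (fun hlt => Run.rput ?_) (fun hlt => Run.skip ?_)))))).mono
      ?_ (hfin))
    · rw [hev]
      simp [BExpr.holds, RExpr.eval, NExpr.eval, hx, hne] at hlt ⊢
      intro a j
      by_cases h : a = arr
      · by_cases hj : j = v
        · simp [h, hj, max_eq_right hlt.le]
        · simp [h, hj]
      · simp [h]
    · rw [hev]
      simp [BExpr.holds, RExpr.eval, NExpr.eval, hx, hne] at hlt ⊢
      intro a j
      by_cases h : a = arr
      · by_cases hj : j = v
        · simp [h, hj, max_eq_left hlt]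
        · simp [h, hj]
      · simp [h]
    · simp [BExpr.cost, RExpr.cost, NExpr.cost]
  · rintro e σ₁ ⟨hn, hr, ha, i, hx, hie, hi0, hiK, hd⟩ hb
    simp only [BExpr.holds, NExpr.eval, hx] at hb
    refine ⟨hn, hr, ha, fun j r hj hrj => hd j r hj hrj ?_⟩
    have : 0 < 2 ^ (K - j) := by positivity
    omega
  · intro x hx
    simp [hx]
  · simp
  · simp
  · simp [NExpr.eval, hs]
  · intro j r hj hrj hle
    obtain rfl : j = 0 := by
      by_contra hj0
      have : 2 * 2 ^ (K - j) ≤ 2 ^ K := by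
        rw [← pow_succ']
        exact Nat.pow_le_pow_right (by norm_num) (by omega)
      omega
    simp only [Nat.sub_zero, pow_zero, mul_one, rangeMax_succ, Store.setN_rarr] at hrj ⊢
    exact hf r hrj
  · simp only [BExpr.cost, NExpr.cost]
    omega

end

end RealRAM

/-! ### The algorithm and its running time -/

namespace RealRAM

theorem run_sinkProgram {N : PathNetwork} {k B : ℕ} (hU : N.IsUniform) (hk : 1 ≤ k)
    (hB : 4 * N.n ≤ B) (hkB : k ≤ B) :
    ∃ K, 2 ^ K ≤ 2 * N.n ∧ Run B sinkProgram (N.input k) (600 * N.n + solveCost k K) fun σ' =>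
      ∃ t, (∀ t', N.Feasible t' k → t ≤ t') ∧ N.Covers t (σ'.narr 0) (σ'.rarr 3) k N.n := by
  have hn := N.n_pos
  -- The first loop of the program arrives at this power of two, the only one in the range.
  obtain ⟨K, hK, hK'⟩ : ∃ K, N.n < 2 ^ K ∧ 2 ^ K ≤ 2 * N.n := by
    refine ⟨Nat.log 2 N.n + 1, Nat.lt_pow_succ_log_self (by norm_num) _, ?_⟩
    have := Nat.pow_log_le_self 2 hn.ne'
    rw [pow_succ]
    omega
  refine ⟨K, hK', ?_⟩
  refine (Run.seq ((run_initSize (by omega) (inputMem_input N k)).mono le_rfl ?_)).mono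
    (c₁ := N.n * 9 + 7 + ((2 ^ K * 60 + 6) + ((2 ^ K * 50 + 6) + ((2 ^ K * 50 + 6) +
      solveCost k K)))) (by omega) (fun _ h => h)
  rintro σ₁ ⟨hi₁, hr₁, K', hs₁, hK₁, hK₂⟩
  obtain rfl : K' = K := by
    have h1 : 2 ^ K' < 2 ^ (K + 1) := by rw [pow_succ]; omega
    have h2 : 2 ^ K < 2 ^ (K' + 1) := by rw [pow_succ]; omega
    have h1 := (Nat.pow_lt_pow_iff_right (by norm_num)).1 h1
    have h2 := (Nat.pow_lt_pow_iff_right (by norm_num)).1 h2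
    omega
  refine Run.seq ((run_fillArrays (by omega) hi₁ hs₁ hK ?_ ?_).mono le_rfl ?_)
  · simp [hr₁, PathNetwork.input]
  · simp [hr₁, PathNetwork.input]
  rintro σ₂ ⟨hi₂, hs₂, hload, htravel, hL, hR⟩
  refine Run.seq ((run_buildTree aKeyL (by omega) hs₂ hL).mono le_rfl ?_)
  rintro σ₃ ⟨hn₃, hr₃, ha₃, ht₃⟩
  refine Run.seq ((run_buildTree (f := N.keyR) aKeyR (by omega)
    ((hn₃ _ (by norm_num)).trans hs₂) ?_).mono le_rfl ?_)
  · rw [ha₃ _ (by norm_num)]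
    exact hR
  rintro σ₄ ⟨hn₄, hr₄, ha₄, ht₄⟩
  refine run_solve hU hk (by omega) hkB hK ⟨?_, ?_, ?_, ?_, ?_, ?_, ?_, ht₄⟩
  · rw [hn₄ _ (by norm_num), hn₃ _ (by norm_num), hi₂.n]
  · rw [hn₄ _ (by norm_num), hn₃ _ (by norm_num), hi₂.k]
  · rw [hn₄ _ (by norm_num), hn₃ _ (by norm_num), hs₂]
  · rw [hr₄, hr₃, hi₂.tau]
  · rw [ha₄ _ (by norm_num), ha₃ _ (by norm_num)]
    exact hload
  · rw [ha₄ _ (by norm_num), ha₃ _ (by norm_num)]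
    exact htravel
  · rw [ha₄ _ (by norm_num)]
    exact ht₃

lemma solveCost_le {k K : ℕ} (hk : 1 ≤ k) :
    solveCost k K ≤ 6000 * (k ^ 2 * (K + 1) ^ 2) := by
  obtain ⟨k, rfl⟩ : ∃ m, k = m + 1 := ⟨k - 1, by omega⟩
  simp only [solveCost, placeCost, stepCost]
  ring_nf
  nlinarith [Nat.zero_le (k * K), Nat.zero_le (k * K ^ 2), Nat.zero_le (k ^ 2 * K),
    Nat.zero_le (k ^ 2 * K ^ 2), Nat.zero_le (k ^ 2), Nat.zero_le (K ^ 2)]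

/-- The number of levels of the tree is logarithmic; for a single vertex, where the logarithm
vanishes, the time is bounded since there is one sink only. -/
lemma cost_le {n k K T : ℕ} (hn : 0 < n) (hnk : 2 ≤ n ∨ k = 1) (hK : 2 ^ K ≤ 2 * n)
    (hT : T ≤ 600 * n + 6000 * (k ^ 2 * (K + 1) ^ 2)) :
    (T : ℝ) ≤ (150000 : ℕ) * ((n : ℝ) + (k : ℝ) ^ 2 * (Real.log (n : ℝ)) ^ 2) := by
  have hT' : (T : ℝ) ≤ 600 * n + 6000 * (k ^ 2 * (K + 1) ^ 2) := by exact_mod_cast hT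
  have hn1 : (1 : ℝ) ≤ n := by exact_mod_cast hn
  rcases (show n = 1 ∨ 2 ≤ n by omega) with rfl | hn2
  · obtain rfl : k = 1 := by omega
    have hK1 : K ≤ 1 := by
      by_contra! h
      have : 2 ^ 2 ≤ 2 ^ K := Nat.pow_le_pow_right (by norm_num) h
      omega
    have hK1' : (K : ℝ) ≤ 1 := by exact_mod_cast hK1
    have hK0 : (0 : ℝ) ≤ K := Nat.cast_nonneg _
    norm_num at hT' ⊢
    nlinarith
  · have hlog2 := Real.log_two_gt_d9
    have hlog : Real.log 2 ≤ Real.log n :=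
      Real.log_le_log (by norm_num) (by exact_mod_cast hn2)
    have hKlog : K * Real.log 2 ≤ Real.log 2 + Real.log n := by
      rw [← Real.log_pow, ← Real.log_mul (by norm_num) (by positivity)]
      exact Real.log_le_log (by positivity) (by exact_mod_cast hK)
    have hK5 : (K : ℝ) + 1 ≤ 5 * Real.log n := by
      have hK0 : (0 : ℝ) ≤ K := Nat.cast_nonneg _
      nlinarith
    have hsq : ((K : ℝ) + 1) ^ 2 ≤ 25 * Real.log n ^ 2 := by
      have := pow_le_pow_left₀ (by positivity) hK5 2
      linarith
    have hmul := mul_le_mul_of_nonneg_left hsq (sq_nonneg (k : ℝ))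
    push_cast
    linarith

end RealRAM

theorem mainTheorem3 :
    ∃ (P : RealRAM.Prog) (C D : ℕ),
      ∀ (N : PathNetwork) (k : ℕ), N.IsUniform → 1 ≤ k → (2 ≤ N.n ∨ k = 1) →
        ∃ (T : ℕ) (σ : RealRAM.Store) (S : Fin k → N.Point),
          RealRAM.Exec ((N.n + k + 1) ^ D) P (N.input k) T σ ∧
          (T : ℝ) ≤ C * ((N.n : ℝ) + (k : ℝ) ^ 2 * (Real.log (N.n : ℝ)) ^ 2) ∧
          PathNetwork.IsOutput σ S ∧
          N.IsOptimalSink S := by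
  refine ⟨RealRAM.sinkProgram, 150000, 2, fun N k hU hk hnk => ?_⟩
  have hn := N.n_pos
  have hB : 4 * N.n ≤ (N.n + k + 1) ^ 2 := by nlinarith
  have hkB : N.n + k ≤ (N.n + k + 1) ^ 2 := by nlinarith
  obtain ⟨K, hK, hrun⟩ := RealRAM.run_sinkProgram hU hk hB (by omega)
  have hbounded : (N.input k).Bounded ((N.n + k + 1) ^ 2) := by
    intro x
    simp only [PathNetwork.input]
    split_ifs <;> omega
  obtain ⟨T, σ, hE, hT, -, t, hopt, hcov⟩ := hrun hbounded
  obtain ⟨S, hout, hS⟩ := hcov.sinksEvacuate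
  refine ⟨T, σ, S, hE, RealRAM.cost_le hn hnk hK (hT.trans ?_), hout, t, hS, hopt⟩
  have := RealRAM.solveCost_le (K := K) hk
  omega
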